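/- Let $G$ be a finite group and $F$ a number field. For $\alpha\in\mathbb{Q}G$ and $g\in G$ put $\alpha^g=g^{-1}\alpha g$; likewise $h^g=g^{-1}hg$. For $M\le G$ put $\widehat{M}=\frac{1}{|M|}\sum_{m\in M}m\in\mathbb{Q}G$. For $K\unlhd H\le G$ let $\varepsilon(H,K)=\widehat{K}\prod_{M}(1-\widehat{M})$, where $M/K$ runs over the minimal nontrivial normal subgroups of $H/K$ (so $\varepsilon(H,H)=\widehat{H}$), and let $e(G,H,K)$ be the sum of the distinct $G$-conjugates of $\varepsilon(H,K)$. A *strong Shoda pair* of $G$ is a pair $(H,K)$ of subgroups of $G$ such that $K\le H\unlhd N_G(K)$, the group $H/K$ is cyclic and a maximal abelian subgroup of $N_G(K)/K$, and $\varepsilon(H,K)\,\varepsilon(H,K)^g=0$ for every $g\in G\setminus N_G(K)$. The group $G$ is *strongly monomial* if every irreducible complex character of $G$ is induced from a linear character of $H$ with kernel $K$, for some strong Shoda pair $(H,K)$ of $G$. A *complete set of representatives of strong Shoda pairs* is a set $X$ of strong Shoda pairs of $G$ such that $e(G,H_1,K_1)\ne e(G,H_2,K_2)$ for distinct $(H_1,K_1),(H_2,K_2)\in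 X$, and $\sum_{(H,K)\in X}e(G,H,K)=1$. For $k\ge 1$ let $I_k(F)\le \mathcal{U}(\mathbb{Z}/k\mathbb{Z})$ be the image of $\mathrm{Gal}(F(\zeta_k)/F)$ under $\sigma\mapsto t$, where $\sigma(\zeta_k)=\zeta_k^t$. For a strong Shoda pair $(H,K)$ with $k=[H:K]$ and $H/K=\langle hK\rangle$: * $\mathcal{U}_{(H,K)}=\{r\in\mathcal{U}(\mathbb{Z}/k\mathbb{Z}) \mid h^g h^{-r}\in K\text{ for some } g\in N_G(K)\}$; * $\mathcal{C}_F(H/K)$ is the set of orbits of the faithful linear characters of $H/K$ (with values in $F(\zeta_k)$) under $\mathrm{Gal}(F(\zeta_k)/F)$, and $E_F(G,H/K)$ is the stabilizer of an orbit $C\in\mathcal{C}_F(H/K)$ under the conjugation action of $N_G(H)\cap N_G(K)$ (it does not depend on $C$); * $N_G(K)/H$ acts on $\mathbb{Q}(\zeta_k)$, where $gH$ acts by $\zeta_k\mapsto\zeta_k^i$ if $h^gK=h^iK$; the fixed field is denoted $\mathbb{Q}(\zeta_k)^{N_G(K)/H}$, and it is intersected with $F$ inside $F(\zeta_k)$.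 **Proposition.** Let $G$ be a finite strongly monomial group, $F$ a number field, and $X$ a complete set of representatives of strong Shoda pairs of $G$. For each $(H,K)\in X$ fix a generator $hK$ of $H/K$ and an orbit $C\in\mathcal{C}_F(H/K)$; the notions above are formed with these, and the choices are arbitrary. Then the following are equivalent: 1. the number of simple components of $FG$ equals the number of simple components of $\mathbb{Q}G$; 2. $\mathcal{U}(\mathbb{Z}/[H:K]\mathbb{Z})=\langle I_{[H:K]}(F),\ \mathcal{U}_{(H,K)}\rangle$ for every $(H,K)\in X$; 3. $\phi([H:K])=|I_{[H:K]}(F)|\,\dfrac{|N_G(K)|}{|E_F(G,H/K)|}$ for every $(H,K)\in X$; 4. $[\mathbb{Q}(\zeta_{[H:K]})^{N_G(K)/H}\cap F:\mathbb{Q}]=1$, i.e. $\mathbb{Q}(\zeta_{[H:K]})^{N_G(K)/H}\cap F=\mathbb{Q}$, for every $(H,K)\in X$. -/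

import Mathlib

noncomputable section

namespace StrongShoda

/-! ### Idempotents of the rational group algebra -/

section Idempotents

variable {G : Type*} [Group G] [Finite G]

/-- The element `|M|⁻¹ ∑_{m ∈ M} m` of the rational group algebra. -/
def hat (M : Subgroup G) : MonoidAlgebra ℚ G :=
  (Nat.card M : ℚ)⁻¹ • ∑ᶠ m : M, MonoidAlgebra.of ℚ G (m : G)

/-- `α ^ g = g⁻¹ α g`. -/
def conjElem (g : G) (α : MonoidAlgebra ℚ G) : MonoidAlgebra ℚ G :=
  MonoidAlgebra.of ℚ G g⁻¹ * α * MonoidAlgebra.of ℚ G g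

/-- `K < M ≤ H` with `M` normal in `H`: for `K` normal in `H`, these `M` correspond to the
nontrivial normal subgroups `M / K` of `H / K`. -/
def NormalBetween (H K M : Subgroup G) : Prop :=
  K < M ∧ M ≤ H ∧ (M.subgroupOf H).Normal

/-- The subgroups `M` for which `M / K` is a minimal nontrivial normal subgroup of `H / K`. -/
def minimalNormals (H K : Subgroup G) : Finset (Subgroup G) :=
  (Set.toFinite {M : Subgroup G | Minimal (NormalBetween H K) M}).toFinset

theorem of_mul_hat (M : Subgroup G) (g : G) (hg : ∀ m, m ∈ M ↔ g * m * g⁻¹ ∈ M) :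
    MonoidAlgebra.of ℚ G g * hat M = hat M * MonoidAlgebra.of ℚ G g := by
  classical
  have := Fintype.ofFinite M
  let φ : M ≃ M :=
    { toFun := fun m => ⟨g * m * g⁻¹, (hg m).1 m.2⟩
      invFun := fun m => ⟨g⁻¹ * m * g, by
        rw [hg]
        have : g * (g⁻¹ * (m : G) * g) * g⁻¹ = m := by group
        rw [this]
        exact m.2⟩
      left_inv := fun m => by ext; simp [mul_assoc]
      right_inv := fun m => by ext; simp [mul_assoc] }
  unfold hat
  rw [finsum_eq_sum_of_fintype, mul_smul_comm, smul_mul_assoc, Finset.mul_sum, Finset.sum_mul]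
  congr 1
  rw [← Equiv.sum_comp φ (fun m : M => MonoidAlgebra.of ℚ G (m : G) * MonoidAlgebra.of ℚ G g)]
  refine Finset.sum_congr rfl fun m _ => ?_
  rw [← map_mul, ← map_mul]
  congr 1
  simp [φ]

theorem hat_commute (H K M₁ M₂ : Subgroup G) (h₁ : NormalBetween H K M₁)
    (h₂ : NormalBetween H K M₂) : Commute (hat M₁) (hat M₂) := by
  classical
  have := Fintype.ofFinite M₁
  have key : ∀ m : M₁, Commute (MonoidAlgebra.of ℚ G (m : G)) (hat M₂) := by
    intro m
    refine of_mul_hat M₂ m fun x => ?_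
    have hm : (m : G) ∈ H := h₁.2.1 m.2
    constructor
    · intro hx
      exact h₂.2.2.conj_mem ⟨x, h₂.2.1 hx⟩ hx ⟨m, hm⟩
    · intro hx
      have := h₂.2.2.conj_mem ⟨_, h₂.2.1 hx⟩ hx (⟨m, hm⟩⁻¹ : H)
      simpa [Subgroup.mem_subgroupOf, mul_assoc] using this
  unfold hat at key ⊢
  rw [finsum_eq_sum_of_fintype]
  exact (Commute.sum_left _ _ _ fun m _ => key m).smul_left _

/-- `ε(H, K) = K̂ ∏ (1 - M̂)`, the product over the minimal nontrivial normal subgroups `M / K`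
of `H / K`. For `H = K` the product is empty and `ε(H, H) = Ĥ`. -/
def epsilon (H K : Subgroup G) : MonoidAlgebra ℚ G :=
  hat K * (minimalNormals H K).noncommProd (fun M => 1 - hat M) (by
    intro M₁ h₁ M₂ h₂ _
    have h₁' : NormalBetween H K M₁ := by
      simp only [minimalNormals, Set.Finite.coe_toFinset, Set.mem_ofPred_eq] at h₁
      exact h₁.prop
    have h₂' : NormalBetween H K M₂ := by
      simp only [minimalNormals, Set.Finite.coe_toFinset, Set.mem_ofPred_eq] at h₂
      exact h₂.prop
    exact ((Commute.one_left _).sub_left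
      ((Commute.one_right _).sub_right (hat_commute H K M₁ M₂ h₁' h₂'))))

/-- `e(G, H, K)`: the sum of the distinct `G`-conjugates of `ε(H, K)`. -/
def e (H K : Subgroup G) : MonoidAlgebra ℚ G :=
  ∑ᶠ a ∈ Set.range (fun g : G => conjElem g (epsilon H K)), a

end Idempotents

/-! ### Strong Shoda pairs and strongly monomial groups -/

section Pairs

variable {G : Type*} [Group G]

/-- `H / K` as a subgroup of `N_G(K) / K`. -/
def quot (H K : Subgroup G) :
    Subgroup (Subgroup.normalizer (K : Set G) ⧸ K.subgroupOf (Subgroup.normalizer (K : Set G))) :=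
  (H.subgroupOf (Subgroup.normalizer (K : Set G))).map (QuotientGroup.mk' _)

structure IsStrongShodaPair [Finite G] (H K : Subgroup G) : Prop where
  le : K ≤ H
  le_normalizer : H ≤ Subgroup.normalizer (K : Set G)
  normal : (H.subgroupOf (Subgroup.normalizer (K : Set G))).Normal
  cyclic : IsCyclic (quot H K)
  maximal_abelian : Maximal (fun A : Subgroup (Subgroup.normalizer (K : Set G) ⧸
    K.subgroupOf (Subgroup.normalizer (K : Set G))) => IsMulCommutative A) (quot H K)
  orthogonal : ∀ g : G, g ∉ Subgroup.normalizer (K : Set G) →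
    epsilon H K * conjElem g (epsilon H K) = 0

/-- `χ` is the character of an irreducible complex representation of `G`. -/
def IsIrreducibleCharacter (χ : G → ℂ) : Prop :=
  ∃ (n : ℕ) (ρ : Representation ℂ G (Fin n → ℂ)), ρ.IsIrreducible ∧ ρ.character = χ

open Classical in
/-- The character of `G` induced from the linear character `ψ` of `H`. -/
def inducedCharacter (H : Subgroup G) (ψ : H →* ℂˣ) (g : G) : ℂ :=
  (Nat.card H : ℂ)⁻¹ *
    ∑ᶠ x : G, if hx : x * g * x⁻¹ ∈ H then ((ψ ⟨x * g * x⁻¹, hx⟩ : ℂˣ) : ℂ) else 0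

variable (G) in
def IsStronglyMonomial [Finite G] : Prop :=
  ∀ χ : G → ℂ, IsIrreducibleCharacter χ →
    ∃ H K : Subgroup G, IsStrongShodaPair H K ∧
      ∃ ψ : H →* ℂˣ, ψ.ker = K.subgroupOf H ∧ χ = inducedCharacter H ψ

/-- `X` is a complete set of representatives of strong Shoda pairs of `G`; two strong Shoda pairs
are equivalent when their elements `e(G, H, K)` coincide. -/
structure IsCompleteSet [Finite G] (X : Finset (Subgroup G × Subgroup G)) : Prop where
  isStrongShodaPair : ∀ p ∈ X, IsStrongShodaPair p.1 p.2
  inequivalent : ∀ p ∈ X, ∀ q ∈ X, e p.1 p.2 = e q.1 q.2 → p = q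
  sum_eq_one : ∑ p ∈ X, e p.1 p.2 = 1

/-- `h` lies in `H`, and its coset generates `H / K`. -/
def IsGenerator (H K : Subgroup G) (h : G) : Prop :=
  h ∈ H ∧ ∀ x ∈ H, ∃ n : ℤ, x * (h ^ n)⁻¹ ∈ K

end Pairs

/-! ### The number of simple components -/

/-- The number of simple components of a semisimple ring: its simple components are its
minimal nonzero two-sided ideals. -/
def numSimpleComponents (A : Type*) [Ring A] : ℕ :=
  Nat.card {I : TwoSidedIdeal A // IsAtom I}

/-! ### Galois groups, orbits of faithful characters and stabilizers -/

section Galois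

variable {G : Type*} [Group G]

instance neZero_relIndex [Finite G] (H K : Subgroup G) : NeZero (K.relIndex H) :=
  ⟨Subgroup.FiniteIndex.index_ne_zero⟩

/-- A primitive `k`-th root of unity `ζ_k` in `F(ζ_k)`. -/
def zeta (F : Type*) [Field F] [NumberField F] (k : ℕ) [NeZero k] : CyclotomicField k F :=
  IsCyclotomicExtension.zeta k F (CyclotomicField k F)

/-- `I_k(F)`: the image of `Gal(F(ζ_k) / F)` in the unit group of `ℤ / kℤ`, where `σ` is sent to
the class of `t` with `σ(ζ_k) = ζ_k ^ t`. -/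
def galoisImage (F : Type*) [Field F] [NumberField F] (k : ℕ) [NeZero k] : Subgroup (ZMod k)ˣ :=
  (IsPrimitiveRoot.autToPow F
    (IsCyclotomicExtension.zeta_spec k F (CyclotomicField k F))).range

/-- `U_(H,K) = {r ∈ U(ℤ / [H:K]ℤ) | h^g h^(-r) ∈ K for some g ∈ N_G(K)}`, where `H / K = ⟨hK⟩`. -/
def conjUnits (H K : Subgroup G) (h : G) : Set (ZMod (K.relIndex H))ˣ :=
  {r | ∃ g ∈ Subgroup.normalizer (K : Set G),
    g⁻¹ * h * g * (h ^ (r : ZMod (K.relIndex H)).val)⁻¹ ∈ K}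

/-- The orbit of a linear character `χ` under `Gal(L / F)`. -/
def galoisOrbit (F : Type*) {L : Type*} [Field F] [Field L] [Algebra F L] {H : Subgroup G}
    (χ : H →* Lˣ) : Set (H →* Lˣ) :=
  Set.range fun σ : L ≃ₐ[F] L => (Units.map (σ : L →* L)).comp χ

/-- `C_F(H / K)`: the orbits of the faithful characters of `H / K`, that is, of the linear
characters of `H` with kernel `K`, under `Gal(F(ζ_k) / F)` with `k = [H:K]`. They take their values
in `F(ζ_k)`. -/
def orbits (F : Type*) [Field F] [NumberField F] (H K : Subgroup G) :
    Set (Set (H →* (CyclotomicField (K.relIndex H) F)ˣ)) :=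
  {C | ∃ χ : H →* (CyclotomicField (K.relIndex H) F)ˣ,
    χ.ker = K.subgroupOf H ∧ C = galoisOrbit F χ}

/-- `χ ^ g` for `g ∈ N_G(H)`: `χ ^ g (x) = χ (g x g⁻¹)`, that is, `χ ^ g (g⁻¹ x g) = χ x`. -/
def conjChar {L : Type*} [Field L] {H : Subgroup G} (g : Subgroup.normalizer (H : Set G))
    (χ : H →* Lˣ) : H →* Lˣ :=
  χ.comp (H.normalizerMonoidHom g).toMonoidHom

theorem conjChar_one {L : Type*} [Field L] {H : Subgroup G} :
    (conjChar 1 : (H →* Lˣ) → (H →* Lˣ)) = id := by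
  ext χ x
  simp [conjChar]

theorem conjChar_mul {L : Type*} [Field L] {H : Subgroup G}
    (a b : Subgroup.normalizer (H : Set G)) :
    (conjChar (a * b) : (H →* Lˣ) → (H →* Lˣ)) = conjChar b ∘ conjChar a := by
  ext χ x
  simp [conjChar]

/-- The stabilizer of `C` under the action of `N_G(H) ∩ N_G(K)`. For `C ∈ C_F(H / K)` this is
`E_F(G, H / K)`. -/
def stab (H K : Subgroup G) {L : Type*} [Field L] (C : Set (H →* Lˣ)) :
    Subgroup (Subgroup.normalizer (H : Set G) ⊓ Subgroup.normalizer (K : Set G) : Subgroup G) where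
  carrier := {g | conjChar (Subgroup.inclusion inf_le_left g) '' C = C}
  one_mem' := by simp [conjChar_one]
  mul_mem' := by
    intro a b ha hb
    simp only [Set.mem_ofPred_eq] at ha hb ⊢
    rw [map_mul, conjChar_mul, Set.image_comp, ha, hb]
  inv_mem' := by
    intro a ha
    simp only [Set.mem_ofPred_eq] at ha ⊢
    conv_lhs => rw [← ha]
    rw [← Set.image_comp, ← conjChar_mul, ← map_mul, mul_inv_cancel, map_one, conjChar_one,
      Set.image_id]

/-- `ℚ(ζ_k)` inside `F(ζ_k)`. -/
def ratCyclotomic (F : Type*) [Field F] [NumberField F] (k : ℕ) [NeZero k] :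
    IntermediateField ℚ (CyclotomicField k F) :=
  IntermediateField.adjoin ℚ {zeta F k}

/-- `F` as a subfield of `F(ζ_k)`. -/
def baseField (F : Type*) [Field F] [NumberField F] (k : ℕ) :
    IntermediateField ℚ (CyclotomicField k F) :=
  (algebraMap F (CyclotomicField k F)).toRatAlgHom.fieldRange

/-- The automorphisms of `ℚ(ζ_k)`, `k = [H:K]`, by which `N_G(K) / H` acts: `gH` acts by
`ζ_k ↦ ζ_k ^ i`, where `g⁻¹ h g K = h ^ i K` and `H / K = ⟨hK⟩`. -/
def actingGroup (F : Type*) [Field F] [NumberField F] [Finite G] (H K : Subgroup G) (h : G) :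
    Subgroup (ratCyclotomic F (K.relIndex H) ≃ₐ[ℚ] ratCyclotomic F (K.relIndex H)) :=
  Subgroup.closure {τ | ∃ g ∈ Subgroup.normalizer (K : Set G), ∃ i : ℕ,
    g⁻¹ * h * g * (h ^ i)⁻¹ ∈ K ∧
      (τ (IntermediateField.AdjoinSimple.gen ℚ (zeta F (K.relIndex H))) :
        CyclotomicField (K.relIndex H) F) = zeta F (K.relIndex H) ^ i}

/-- The fixed field `ℚ(ζ_k)^(N_G(K) / H)`, `k = [H:K]`, inside `F(ζ_k)`. -/
def fixedCyclotomic (F : Type*) [Field F] [NumberField F] [Finite G] (H K : Subgroup G) (h : G) :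
    IntermediateField ℚ (CyclotomicField (K.relIndex H) F) :=
  IntermediateField.lift (IntermediateField.fixedField (actingGroup F H K h))

end Galois

end StrongShoda

end

/-!
The four conditions are compared, one pair `(H, K)` at a time, with the second one. Write
`k = [H:K]`, let `ζ` be a primitive `k`-th root of unity, `L = F(ζ)`, and let `χ` be a character of
`H` with values in `L` and kernel `K`. The characters with kernel `K` are the powers `χ^r`, `r` a
unit of `ℤ / kℤ`, and `ε(H, K)` is the sum of their idempotents `e_(χ^r)` in `LG`
(`mapRingHom_epsilon_eq_sum`). The group `N_G(K)` permutes these idempotents through multiplication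
of `r` by elements of `U_(H,K)` (`exists_conjHom`), and `Gal(L / F)` through multiplication by
elements of `I_k(F)` (`map_comp_char`).

The crucial fact is that `e_ψ · LG · e_ψ = L e_ψ` for `ψ = χ^r`
(`exists_charIdem_mul_mul_charIdem`): for `g ∉ N_G(K)` the element `e_ψ g e_ψ` vanishes by the
orthogonality of the conjugates of `ε(H, K)`, and for `g ∈ N_G(K)` outside `H` because `H / K` is
maximal abelian in `N_G(K) / K`, so that `g` moves `ψ`. Hence a central idempotent `z` of `FG` fixes
or annihilates each `e_(χ^r)`, and the set of those `r` for which it fixes `e_(χ^r)` is stable under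
`I_k(F)` and `U_(H,K)`. Conversely, a stable set of units gives an idempotent with coefficients in
`F`, whose distinct conjugates add up to a central idempotent of `FG`. Therefore `e(G, H, K)` is a
primitive central idempotent of `FG` if and only if `I_k(F)` and `U_(H,K)` generate all units
(`centralIdempotents_trivial_iff`). Over `ℚ` this is always so, as cyclotomic polynomials are
irreducible.

A semisimple ring with `n` simple components has `2 ^ n` central idempotents
(`card_centralIdempotents`), so `FG` and `ℚG` have equally many simple components if and only if
every central idempotent of `FG` lies in `ℚG`. As the `e(G, H, K)` add up to `1`, this means that
all of them remain primitive in `FG` (`numSimpleComponents_eq_iff_forall`).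

The third condition compares orders: `E_F(G, H / K)` is the preimage of `I_k(F)` under the action of
`N_G(K)` on `H / K` (`totient_eq_iff`). The fourth is the Galois correspondence in `ℚ(ζ)`, where an
element lies in `F` if and only if the restrictions of `Gal(L / F)` fix it
(`finrank_eq_one_iff_closure_eq_top`).
-/

noncomputable section

namespace StrongShoda

/-! ### Central idempotents and simple components of a semisimple ring -/

section Semisimple

variable (A : Type*) [Ring A]

/-- The set of central idempotents of `A`. -/
def centralIdempotents : Set A := {z | z ∈ Set.center A ∧ IsIdempotentElem z}

variable {A}

/-- The two-sided ideal generated by a central element: it consists of the multiples of it. -/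
def centralIdeal (z : A) (hz : z ∈ Set.center A) : TwoSidedIdeal A :=
  .mk' {x | ∃ a, x = a * z} ⟨0, by simp⟩
    (by rintro _ _ ⟨a, rfl⟩ ⟨b, rfl⟩; exact ⟨a + b, (add_mul ..).symm⟩)
    (by rintro _ ⟨a, rfl⟩; exact ⟨-a, (neg_mul ..).symm⟩)
    (by rintro x _ ⟨a, rfl⟩; exact ⟨x * a, (mul_assoc ..).symm⟩)
    (by
      rintro _ y ⟨a, rfl⟩
      exact ⟨a * y, by rw [mul_assoc, mul_assoc, (Semigroup.mem_center_iff.1 hz y)]⟩)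

theorem mem_centralIdeal {z : A} (hz : z ∈ Set.center A) {x : A} :
    x ∈ centralIdeal z hz ↔ ∃ a, x = a * z := by
  unfold centralIdeal
  rw [TwoSidedIdeal.mem_mk']
  rfl

theorem mem_centralIdeal_iff_mul_eq {z : A} (hz : z ∈ Set.center A) (hi : IsIdempotentElem z)
    {x : A} : x ∈ centralIdeal z hz ↔ x * z = x := by
  rw [mem_centralIdeal]
  constructor
  · rintro ⟨a, rfl⟩
    rw [mul_assoc, hi.eq]
  · exact fun h => ⟨x, h.symm⟩

theorem centralIdeal_injective :
    Function.Injective fun z : centralIdempotents A => centralIdeal z.1 z.2.1 := by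
  rintro ⟨z, hz, hzi⟩ ⟨w, hw, hwi⟩ h
  simp only at h
  have h1 : z * w = z := (mem_centralIdeal_iff_mul_eq hw hwi).1
    (h ▸ (mem_centralIdeal_iff_mul_eq hz hzi).2 hzi.eq)
  have h2 : w * z = w := (mem_centralIdeal_iff_mul_eq hz hzi).1
    (h ▸ (mem_centralIdeal_iff_mul_eq hw hwi).2 hwi.eq)
  ext
  exact h1.symm.trans ((Semigroup.mem_center_iff.1 hw z).trans h2)

/-- The components of `1` with respect to a decomposition into two complementary two-sided ideals
are central idempotents. -/
theorem exists_centralIdempotent_of_isCompl {I J : TwoSidedIdeal A} (h : IsCompl I J) :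
    ∃ (z : A) (hz : z ∈ Set.center A), IsIdempotentElem z ∧ centralIdeal z hz = I := by
  have h1 : (1 : A) ∈ I ⊔ J := h.sup_eq_top ▸ TwoSidedIdeal.mem_top A
  obtain ⟨z, hzI, w, hwJ, hzw⟩ := TwoSidedIdeal.mem_sup.1 h1
  have hIJ : ∀ x, x ∈ I → x ∈ J → x = 0 := fun x hI hJ =>
    (TwoSidedIdeal.mem_bot A).1 (h.inf_eq_bot ▸ (TwoSidedIdeal.mem_inf A).2 ⟨hI, hJ⟩)
  have hw : w = 1 - z := eq_sub_of_add_eq' hzw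
  have hzc : z ∈ Set.center A := by
    refine Semigroup.mem_center_iff.2 fun a => sub_eq_zero.1 (hIJ _ ?_ ?_)
    · exact I.sub_mem (I.mul_mem_left _ _ hzI) (I.mul_mem_right _ _ hzI)
    · have : a * z - z * a = w * a - a * w := by rw [hw]; noncomm_ring
      rw [this]
      exact J.sub_mem (J.mul_mem_right _ _ hwJ) (J.mul_mem_left _ _ hwJ)
  have hmul : ∀ x ∈ I, x * z = x := by
    intro x hx
    have : x * w = 0 := hIJ _ (I.mul_mem_right _ _ hx) (J.mul_mem_left _ _ hwJ)
    rw [hw, mul_sub, mul_one, sub_eq_zero] at this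
    exact this.symm
  refine ⟨z, hzc, hmul z hzI, ?_⟩
  ext x
  rw [mem_centralIdeal]
  exact ⟨fun ⟨a, ha⟩ => ha ▸ I.mul_mem_left _ _ hzI, fun hx => ⟨x, (hmul x hx).symm⟩⟩

/-- The two-sided ideals of a semisimple ring are the sums of its isotypic components. -/
def twoSidedIdealOrderIso [IsSemisimpleRing A] :
    TwoSidedIdeal A ≃o Set (isotypicComponents A A) :=
  (TwoSidedIdeal.orderIsoIsTwoSided.trans
    { toFun := fun I => ⟨I.1, isFullyInvariant_iff_isTwoSided.2 I.2⟩
      invFun := fun I => ⟨I.1, isFullyInvariant_iff_isTwoSided.1 I.2⟩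
      left_inv := fun _ => rfl
      right_inv := fun _ => rfl
      map_rel_iff' := Iff.rfl :
        {I : Ideal A // I.IsTwoSided} ≃o fullyInvariantSubmodule A A }).trans
    OrderIso.setIsotypicComponents.symm

variable (A) in
/-- A semisimple ring with `n` simple components has `2 ^ n` central idempotents. -/
theorem card_centralIdempotents [IsSemisimpleRing A] :
    Nat.card (centralIdempotents A) = 2 ^ numSimpleComponents A := by
  let φ := twoSidedIdealOrderIso (A := A)
  have hcompl : ComplementedLattice (TwoSidedIdeal A) := φ.symm.complementedLattice
  have h1 : Nat.card (centralIdempotents A) = Nat.card (TwoSidedIdeal A) := by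
    refine Nat.card_congr (Equiv.ofBijective _ ⟨centralIdeal_injective, fun I => ?_⟩)
    obtain ⟨J, hJ⟩ := exists_isCompl I
    obtain ⟨z, hz, hi, h⟩ := exists_centralIdempotent_of_isCompl hJ
    exact ⟨⟨z, hz, hi⟩, h⟩
  have h2 : numSimpleComponents A = Nat.card (isotypicComponents A A) := by
    unfold numSimpleComponents
    have e1 : {I : TwoSidedIdeal A // IsAtom I} ≃ {s : Set (isotypicComponents A A) // IsAtom s} :=
      φ.toEquiv.subtypeEquiv fun I => (φ.isAtom_iff I).symm
    have e2 : isotypicComponents A A ≃ {s : Set (isotypicComponents A A) // IsAtom s} :=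
      Equiv.ofBijective (fun c => ⟨{c}, Set.isAtom_singleton c⟩)
        ⟨fun a b h => Set.singleton_injective (Subtype.ext_iff.1 h), fun ⟨s, hs⟩ => by
          obtain ⟨c, rfl⟩ := Set.isAtom_iff.1 hs
          exact ⟨c, rfl⟩⟩
    exact Nat.card_congr (e1.trans e2.symm)
  rw [h1, h2, Nat.card_congr φ.toEquiv]
  have := Fintype.ofFinite (isotypicComponents A A)
  simp [Nat.card_eq_fintype_card]

/-- An injective ring homomorphism between semisimple rings that carries the centre to the centre
preserves the number of simple components exactly when every central idempotent of the target is an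
image of one of the source. -/
theorem numSimpleComponents_eq_iff {B : Type*} [Ring B] [IsSemisimpleRing A] [IsSemisimpleRing B]
    (f : A →+* B) (hf : Function.Injective f) (hc : ∀ z ∈ Set.center A, f z ∈ Set.center B) :
    numSimpleComponents B = numSimpleComponents A ↔
      ∀ z ∈ centralIdempotents B, ∃ w ∈ centralIdempotents A, f w = z := by
  have hfin : Finite (centralIdempotents B) :=
    Nat.finite_of_card_ne_zero (by rw [card_centralIdempotents]; positivity)
  let g : centralIdempotents A → centralIdempotents B :=
    fun w => ⟨f w, hc _ w.2.1, w.2.2.map f⟩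
  have hg : Function.Injective g := fun a b h => Subtype.ext (hf (Subtype.ext_iff.1 h))
  have key : numSimpleComponents B = numSimpleComponents A ↔
      Nat.card (centralIdempotents B) = Nat.card (centralIdempotents A) := by
    rw [card_centralIdempotents, card_centralIdempotents, (Nat.pow_right_injective le_rfl).eq_iff]
  rw [key]
  constructor
  · intro h z hz
    obtain ⟨w, hw⟩ := (hg.bijective_of_nat_card_le h.le).2 ⟨z, hz⟩
    exact ⟨w, w.2, Subtype.ext_iff.1 hw⟩
  · intro h
    refine (Nat.card_congr (Equiv.ofBijective g ⟨hg, fun z => ?_⟩)).symm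
    obtain ⟨w, hw, hwz⟩ := h z z.2
    exact ⟨⟨w, hw⟩, Subtype.ext hwz⟩

end Semisimple

/-! ### Sums of conjugates of an idempotent of a group algebra -/

section ConjSum

variable {R S G : Type*} [CommRing R] [CommRing S] [Group G]

/-- `a ^ g = g⁻¹ a g` in a group algebra. -/
def conjBy (g : G) (a : MonoidAlgebra R G) : MonoidAlgebra R G :=
  MonoidAlgebra.of R G g⁻¹ * a * MonoidAlgebra.of R G g

/-- The sum of the distinct `G`-conjugates of an element of a group algebra. -/
def conjSum (a : MonoidAlgebra R G) : MonoidAlgebra R G :=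
  ∑ᶠ b ∈ Set.range fun g : G => conjBy g a, b

theorem mem_center_of_commute_of {z : MonoidAlgebra R G}
    (h : ∀ g : G, MonoidAlgebra.of R G g * z = z * MonoidAlgebra.of R G g) :
    z ∈ Set.center (MonoidAlgebra R G) := by
  refine Semigroup.mem_center_iff.2 fun a => ?_
  induction a using MonoidAlgebra.induction_on with
  | of g => exact h g
  | add a b ha hb => rw [add_mul, mul_add, ha, hb]
  | smul r a ha => rw [smul_mul_assoc, mul_smul_comm, ha]

theorem of_inv_mul_of (g : G) : MonoidAlgebra.of R G g⁻¹ * MonoidAlgebra.of R G g = 1 := by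
  rw [← map_mul, inv_mul_cancel, map_one]

theorem of_mul_of_inv (g : G) : MonoidAlgebra.of R G g * MonoidAlgebra.of R G g⁻¹ = 1 := by
  rw [← map_mul, mul_inv_cancel, map_one]

theorem conjBy_mul (g : G) (a b : MonoidAlgebra R G) :
    conjBy g (a * b) = conjBy g a * conjBy g b := by
  unfold conjBy
  rw [show MonoidAlgebra.of R G g⁻¹ * a * MonoidAlgebra.of R G g *
    (MonoidAlgebra.of R G g⁻¹ * b * MonoidAlgebra.of R G g) = MonoidAlgebra.of R G g⁻¹ * a *
    (MonoidAlgebra.of R G g * MonoidAlgebra.of R G g⁻¹) * b * MonoidAlgebra.of R G g by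
      simp only [mul_assoc], of_mul_of_inv]
  simp only [mul_assoc, one_mul]

theorem conjBy_conjBy (g h : G) (a : MonoidAlgebra R G) :
    conjBy h (conjBy g a) = conjBy (g * h) a := by
  simp only [conjBy, mul_inv_rev, map_mul, mul_assoc]

theorem conjBy_one (a : MonoidAlgebra R G) : conjBy 1 a = a := by
  rw [conjBy, inv_one, map_one, one_mul, mul_one]

theorem conjBy_zero (g : G) : conjBy g (0 : MonoidAlgebra R G) = 0 := by
  simp [conjBy]

theorem conjBy_sum {ι : Type*} (s : Finset ι) (f : ι → MonoidAlgebra R G) (g : G) :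
    conjBy g (∑ i ∈ s, f i) = ∑ i ∈ s, conjBy g (f i) := by
  simp only [conjBy, Finset.mul_sum, Finset.sum_mul]

theorem conjBy_of_mem_center {z : MonoidAlgebra R G} (hz : z ∈ Set.center (MonoidAlgebra R G))
    (g : G) : conjBy g z = z := by
  unfold conjBy
  rw [Semigroup.mem_center_iff.1 hz, mul_assoc, of_inv_mul_of, mul_one]

theorem mapRingHom_conjBy (f : R →+* S) (g : G) (a : MonoidAlgebra R G) :
    MonoidAlgebra.mapRingHom G f (conjBy g a) = conjBy g (MonoidAlgebra.mapRingHom G f a) := by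
  simp [conjBy]

theorem mapRingHom_injective {f : R →+* S} (hf : Function.Injective f) :
    Function.Injective (MonoidAlgebra.mapRingHom G f) :=
  MonoidAlgebra.map_injective (f : R →+ S) hf

theorem mapRingHom_mem_center (f : R →+* S) {z : MonoidAlgebra R G}
    (hz : z ∈ Set.center (MonoidAlgebra R G)) :
    MonoidAlgebra.mapRingHom G f z ∈ Set.center (MonoidAlgebra S G) := by
  refine mem_center_of_commute_of fun g => ?_
  have := congrArg (MonoidAlgebra.mapRingHom G f)
    (Semigroup.mem_center_iff.1 hz (MonoidAlgebra.of R G g))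
  simpa using this

/-- `a` is an idempotent that is orthogonal to each of its conjugates other than `a`. -/
structure IsConjOrthogonal (a : MonoidAlgebra R G) : Prop where
  idem : a * a = a
  orth : ∀ g, conjBy g a = a ∨ a * conjBy g a = 0

theorem IsConjOrthogonal.of_mapRingHom {f : R →+* S} (hf : Function.Injective f)
    {a : MonoidAlgebra R G} (ha : IsConjOrthogonal (MonoidAlgebra.mapRingHom G f a)) :
    IsConjOrthogonal a where
  idem := mapRingHom_injective hf (by rw [map_mul, ha.idem])
  orth g := (ha.orth g).imp
    (fun h => mapRingHom_injective hf (by rw [mapRingHom_conjBy, h]))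
    (fun h => mapRingHom_injective hf (by rw [map_mul, mapRingHom_conjBy, h, map_zero]))

variable [Finite G]

open Classical in
theorem conjSum_eq_sum (a : MonoidAlgebra R G) :
    conjSum a = ∑ b ∈ (Set.finite_range fun g : G => conjBy g a).toFinset, b := by
  unfold conjSum
  rw [← finsum_mem_finset_eq_sum]
  simp

theorem mapRingHom_conjSum {f : R →+* S} (hf : Function.Injective f) (a : MonoidAlgebra R G) :
    MonoidAlgebra.mapRingHom G f (conjSum a) = conjSum (MonoidAlgebra.mapRingHom G f a) := by
  classical
  rw [conjSum_eq_sum, conjSum_eq_sum, map_sum,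
    ← Finset.sum_image (f := fun b => b) (g := MonoidAlgebra.mapRingHom G f)
      (fun x _ y _ h => mapRingHom_injective hf h)]
  congr 1
  ext b
  simp [mapRingHom_conjBy]

theorem conjBy_conjSum (g : G) (a : MonoidAlgebra R G) : conjBy g (conjSum a) = conjSum a := by
  classical
  rw [conjSum_eq_sum, conjBy_sum]
  refine Finset.sum_nbij' (conjBy g) (conjBy g⁻¹) ?_ ?_ ?_ ?_ ?_
  · intro b hb
    obtain ⟨h, rfl⟩ := (Set.Finite.mem_toFinset _).1 hb
    exact (Set.Finite.mem_toFinset _).2 ⟨h * g, (conjBy_conjBy ..).symm⟩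
  · intro b hb
    obtain ⟨h, rfl⟩ := (Set.Finite.mem_toFinset _).1 hb
    exact (Set.Finite.mem_toFinset _).2 ⟨h * g⁻¹, (conjBy_conjBy ..).symm⟩
  · intro b _
    rw [conjBy_conjBy, mul_inv_cancel, conjBy_one]
  · intro b _
    rw [conjBy_conjBy, inv_mul_cancel, conjBy_one]
  · intro b _
    rfl

theorem conjSum_mem_center (a : MonoidAlgebra R G) :
    conjSum a ∈ Set.center (MonoidAlgebra R G) := by
  refine mem_center_of_commute_of fun g => ?_
  conv_lhs => rw [← conjBy_conjSum g a]
  rw [conjBy, ← mul_assoc, ← mul_assoc, of_mul_of_inv, one_mul]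

theorem mul_conjSum_eq_zero {c a : MonoidAlgebra R G} (h : ∀ g, c * conjBy g a = 0) :
    c * conjSum a = 0 := by
  classical
  rw [conjSum_eq_sum, Finset.mul_sum]
  refine Finset.sum_eq_zero fun b hb => ?_
  obtain ⟨g, rfl⟩ := (Set.Finite.mem_toFinset _).1 hb
  exact h g

theorem mul_conjSum_eq_zero_of_mem_center {z a : MonoidAlgebra R G}
    (hz : z ∈ Set.center (MonoidAlgebra R G)) (h : z * a = 0) : z * conjSum a = 0 :=
  mul_conjSum_eq_zero fun g => by
    rw [← conjBy_of_mem_center hz g, ← conjBy_mul, h, conjBy_zero]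

theorem mul_conjSum_eq_self_of_mem_center {z a : MonoidAlgebra R G}
    (hz : z ∈ Set.center (MonoidAlgebra R G)) (h : z * a = a) : z * conjSum a = conjSum a := by
  classical
  rw [conjSum_eq_sum, Finset.mul_sum]
  refine Finset.sum_congr rfl fun b hb => ?_
  obtain ⟨g, rfl⟩ := (Set.Finite.mem_toFinset _).1 hb
  simp only
  conv_rhs => rw [← h, conjBy_mul, conjBy_of_mem_center hz]

theorem IsConjOrthogonal.mul_conjSum {a : MonoidAlgebra R G} (ha : IsConjOrthogonal a) :
    a * conjSum a = a := by
  classical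
  rw [conjSum_eq_sum, Finset.mul_sum, Finset.sum_eq_single a, ha.idem]
  · intro b hb hba
    obtain ⟨g, rfl⟩ := (Set.Finite.mem_toFinset _).1 hb
    exact (ha.orth g).resolve_left hba
  · exact fun h => (h ((Set.Finite.mem_toFinset _).2 ⟨1, conjBy_one a⟩)).elim

theorem IsConjOrthogonal.conjSum_mem {a : MonoidAlgebra R G} (ha : IsConjOrthogonal a) :
    conjSum a ∈ centralIdempotents (MonoidAlgebra R G) := by
  refine ⟨conjSum_mem_center a, mul_conjSum_eq_self_of_mem_center (conjSum_mem_center a) ?_⟩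
  rw [← Semigroup.mem_center_iff.1 (conjSum_mem_center a), ha.mul_conjSum]

end ConjSum

/-! ### Idempotents attached to linear characters -/

theorem mem_minimalNormals {G : Type*} [Group G] [Finite G] {H K M : Subgroup G} :
    M ∈ minimalNormals H K ↔ Minimal (NormalBetween H K) M := by
  simp [minimalNormals]

theorem exists_epsilon_eq {G : Type*} [Group G] [Finite G] (H K : Subgroup G) :
    ∃ comm : (minimalNormals H K : Set (Subgroup G)).Pairwise
      (Function.onFun Commute fun M => 1 - hat M),
      epsilon H K = hat K * (minimalNormals H K).noncommProd (fun M => 1 - hat M) comm :=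
  ⟨_, rfl⟩

section CharIdem

variable {L G : Type*} [Field L] [Group G]

/-- The idempotent `|H|⁻¹ ∑_{x ∈ H} ψ(x)⁻¹ x` attached to a linear character `ψ` of `H`. -/
def charIdem {H : Subgroup G} (ψ : H →* Lˣ) : MonoidAlgebra L G :=
  (Nat.card H : L)⁻¹ • ∑ᶠ x : H, ((ψ x)⁻¹ : Lˣ).val • MonoidAlgebra.of L G (x : G)

variable {H : Subgroup G}

theorem charIdem_eq_sum [Fintype H] (ψ : H →* Lˣ) : charIdem ψ =
    (Nat.card H : L)⁻¹ • ∑ x : H, ((ψ x)⁻¹ : Lˣ).val • MonoidAlgebra.of L G (x : G) := by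
  rw [charIdem, finsum_eq_sum_of_fintype]

variable [Finite G]

open Classical in
theorem coeff_charIdem (ψ : H →* Lˣ) (g : G) : (charIdem ψ).coeff g =
    if hg : g ∈ H then (Nat.card H : L)⁻¹ * ((ψ ⟨g, hg⟩)⁻¹ : Lˣ).val else 0 := by
  have := Fintype.ofFinite H
  rw [charIdem_eq_sum]
  simp only [MonoidAlgebra.of_apply, MonoidAlgebra.coeff_smul, MonoidAlgebra.coeff_sum,
    MonoidAlgebra.coeff_single, Finsupp.smul_apply, Finsupp.finsetSum_apply, smul_eq_mul,
    Finsupp.single_apply]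
  split_ifs with hg
  · rw [Finset.sum_eq_single ⟨g, hg⟩]
    · simp
    · intro b _ hb
      rw [if_neg fun h => hb (Subtype.ext h), mul_zero]
    · exact fun h => (h (Finset.mem_univ _)).elim
  · rw [Finset.sum_eq_zero, mul_zero]
    intro b _
    rw [if_neg fun h : (b : G) = g => hg (h ▸ b.2), mul_zero]

theorem mapRingHom_hat [CharZero L] (M : Subgroup G) :
    MonoidAlgebra.mapRingHom G (Rat.castHom L) (hat M) = charIdem (1 : M →* Lˣ) := by
  have := Fintype.ofFinite M
  rw [charIdem_eq_sum, hat, finsum_eq_sum_of_fintype]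
  simp only [MonoidAlgebra.of_apply, Finset.smul_sum,
    MonoidAlgebra.smul_single, map_sum, MonoidAlgebra.mapRingHom_single]
  simp

theorem of_mul_charIdem (ψ : H →* Lˣ) (x : H) :
    MonoidAlgebra.of L G (x : G) * charIdem ψ = (ψ x : L) • charIdem ψ := by
  have := Fintype.ofFinite H
  rw [charIdem_eq_sum, mul_smul_comm, smul_comm (ψ x : L), Finset.mul_sum,
    Finset.smul_sum (r := (ψ x : L))]
  congr 1
  conv_rhs => rw [← Equiv.sum_comp (Equiv.mulLeft x)]
  refine Finset.sum_congr rfl fun y _ => ?_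
  rw [mul_smul_comm, ← map_mul, smul_smul]
  simp only [Equiv.coe_mulLeft, map_mul, mul_inv_rev, Units.val_mul, Subgroup.coe_mul]
  rw [mul_left_comm, Units.mul_inv, mul_one]

/-- Orthogonality of linear characters. -/
theorem charIdem_mul_charIdem_of_ne {M : Subgroup G} (hMH : M ≤ H) {φ : M →* Lˣ} {ψ : H →* Lˣ}
    (h : ψ.comp (Subgroup.inclusion hMH) ≠ φ) : charIdem φ * charIdem ψ = 0 := by
  have := Fintype.ofFinite M
  let f : M →* L := (Units.coeHom L).comp (φ⁻¹ * ψ.comp (Subgroup.inclusion hMH))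
  have hf : f ≠ 1 := by
    intro hf
    refine h ?_
    ext x
    have := congrArg (fun f => f x) hf
    simp only [f, MonoidHom.comp_apply, MonoidHom.mul_apply, MonoidHom.inv_apply,
      MonoidHom.one_apply, Units.coeHom_apply, Units.val_eq_one, inv_mul_eq_one] at this
    simp [this]
  rw [charIdem_eq_sum φ, smul_mul_assoc, Finset.sum_mul]
  have : ∀ x ∈ (Finset.univ : Finset M), ((φ x)⁻¹ : Lˣ).val • MonoidAlgebra.of L G (x : G) *
      charIdem ψ = f x • charIdem ψ := by
    intro x _
    rw [smul_mul_assoc, show (x : G) = (Subgroup.inclusion hMH x : H) from rfl, of_mul_charIdem,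
      smul_smul]
    simp [f]
  rw [Finset.sum_congr rfl this, ← Finset.sum_smul, sum_hom_units_eq_zero f hf, zero_smul,
    smul_zero]

theorem charIdem_mul_of_ne {φ ψ : H →* Lˣ} (h : φ ≠ ψ) : charIdem φ * charIdem ψ = 0 :=
  charIdem_mul_charIdem_of_ne le_rfl fun h' => h h'.symm

theorem conjBy_charIdem (g : Subgroup.normalizer (H : Set G)) (ψ : H →* Lˣ) :
    conjBy (g : G) (charIdem ψ) = charIdem (conjChar g ψ) := by
  have := Fintype.ofFinite H
  rw [charIdem_eq_sum, charIdem_eq_sum, conjBy, mul_smul_comm, smul_mul_assoc, Finset.mul_sum,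
    Finset.sum_mul]
  congr 1
  rw [← Equiv.sum_comp (H.normalizerMonoidHom g).toEquiv]
  refine Finset.sum_congr rfl fun y _ => ?_
  rw [mul_smul_comm, smul_mul_assoc, ← map_mul, ← map_mul]
  congr 2
  simp [mul_assoc]

theorem mapRingHom_charIdem {L' : Type*} [Field L'] (σ : L →+* L') (ψ : H →* Lˣ) :
    MonoidAlgebra.mapRingHom G σ (charIdem ψ) =
      charIdem ((Units.map (σ : L →* L')).comp ψ) := by
  classical
  ext g
  rw [MonoidAlgebra.coeff_mapRingHom, coeff_charIdem, coeff_charIdem]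
  split_ifs with hg
  · simp
  · simp

variable [CharZero L]

theorem card_subgroup_ne_zero (H : Subgroup G) : (Nat.card H : L) ≠ 0 :=
  Nat.cast_ne_zero.2 Nat.card_pos.ne'

theorem charIdem_ne_zero (ψ : H →* Lˣ) : charIdem ψ ≠ 0 := by
  classical
  intro h
  have := coeff_charIdem ψ 1
  rw [h, dif_pos H.one_mem] at this
  exact mul_ne_zero (inv_ne_zero (card_subgroup_ne_zero H)) (Units.ne_zero _) this.symm

theorem charIdem_mul_charIdem_of_eq {M : Subgroup G} (hMH : M ≤ H) {φ : M →* Lˣ} {ψ : H →* Lˣ}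
    (h : ψ.comp (Subgroup.inclusion hMH) = φ) : charIdem φ * charIdem ψ = charIdem ψ := by
  have := Fintype.ofFinite M
  rw [charIdem_eq_sum φ, smul_mul_assoc, Finset.sum_mul]
  have : ∀ x ∈ (Finset.univ : Finset M), ((φ x)⁻¹ : Lˣ).val • MonoidAlgebra.of L G (x : G) *
      charIdem ψ = charIdem ψ := by
    intro x _
    rw [smul_mul_assoc, show (x : G) = (Subgroup.inclusion hMH x : H) from rfl, of_mul_charIdem,
      smul_smul, ← h]
    simp
  rw [Finset.sum_congr rfl this, Finset.sum_const, Finset.card_univ, ← Nat.card_eq_fintype_card,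
    ← Nat.cast_smul_eq_nsmul L, smul_smul, inv_mul_cancel₀ (card_subgroup_ne_zero M), one_smul]

theorem charIdem_mul_self (ψ : H →* Lˣ) : charIdem ψ * charIdem ψ = charIdem ψ :=
  charIdem_mul_charIdem_of_eq le_rfl rfl

/-- `M̂` fixes the idempotent of a linear character that is trivial on `M`, and annihilates the
others. -/
theorem mapRingHom_hat_mul_charIdem {M : Subgroup G} (hMH : M ≤ H) (ψ : H →* Lˣ)
    [Decidable (M.subgroupOf H ≤ ψ.ker)] :
    MonoidAlgebra.mapRingHom G (Rat.castHom L) (hat M) * charIdem ψ =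
      if M.subgroupOf H ≤ ψ.ker then charIdem ψ else 0 := by
  rw [mapRingHom_hat]
  have key : ψ.comp (Subgroup.inclusion hMH) = 1 ↔ M.subgroupOf H ≤ ψ.ker := by
    constructor
    · intro h x hx
      exact congrArg (fun f => f ⟨x, hx⟩) h
    · intro h
      refine MonoidHom.ext fun x => h (x := Subgroup.inclusion hMH x) x.2
  split_ifs with h
  · exact charIdem_mul_charIdem_of_eq hMH (key.2 h)
  · exact charIdem_mul_charIdem_of_ne hMH fun h' => h (key.1 h')

/-- The factor `∏ (1 - M̂)` of `ε(H, K)` fixes the idempotents of the characters that are nontrivial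
on every `M`, and annihilates the others. -/
theorem mapRingHom_epsilon (H K : Subgroup G) : ∃ P : MonoidAlgebra L G,
    MonoidAlgebra.mapRingHom G (Rat.castHom L) (epsilon H K) =
      MonoidAlgebra.mapRingHom G (Rat.castHom L) (hat K) * P ∧
    (∀ ψ : H →* Lˣ, (∀ M, Minimal (NormalBetween H K) M → ¬ M.subgroupOf H ≤ ψ.ker) →
      P * charIdem ψ = charIdem ψ) ∧
    (∀ ψ : H →* Lˣ, (∃ M, Minimal (NormalBetween H K) M ∧ M.subgroupOf H ≤ ψ.ker) →
      P * charIdem ψ = 0) := by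
  classical
  obtain ⟨comm, heps⟩ := exists_epsilon_eq H K
  have hfac : ∀ (M : Subgroup G) (ψ : H →* Lˣ), M ∈ minimalNormals H K →
      MonoidAlgebra.mapRingHom G (Rat.castHom L) (1 - hat M) * charIdem ψ =
        if M.subgroupOf H ≤ ψ.ker then 0 else charIdem ψ := by
    intro M ψ hM
    rw [map_sub, map_one, sub_mul, one_mul,
      mapRingHom_hat_mul_charIdem (mem_minimalNormals.1 hM).prop.2.1]
    split_ifs
    · exact sub_self _
    · exact sub_zero _
  refine ⟨MonoidAlgebra.mapRingHom G (Rat.castHom L)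
    ((minimalNormals H K).noncommProd (fun M => 1 - hat M) comm), by rw [heps, map_mul], ?_, ?_⟩
  · intro ψ h
    refine Finset.noncommProd_induction _ _ comm (fun x =>
      MonoidAlgebra.mapRingHom G (Rat.castHom L) x * charIdem ψ = charIdem ψ) ?_ ?_ ?_
    · intro a b ha hb
      rw [map_mul, mul_assoc, hb, ha]
    · rw [map_one, one_mul]
    · intro M hM
      rw [hfac M ψ hM, if_neg (h M (mem_minimalNormals.1 hM))]
  · rintro ψ ⟨M, hM, hMψ⟩
    rw [← Finset.noncommProd_erase_mul _ (mem_minimalNormals.2 hM), map_mul, mul_assoc,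
      hfac M ψ (mem_minimalNormals.2 hM), if_pos hMψ, mul_zero]

theorem mapRingHom_epsilon_mul_charIdem_of_ker_eq {K : Subgroup G} (hKH : K ≤ H) (ψ : H →* Lˣ)
    (hψ : ψ.ker = K.subgroupOf H) :
    MonoidAlgebra.mapRingHom G (Rat.castHom L) (epsilon H K) * charIdem ψ = charIdem ψ := by
  classical
  obtain ⟨P, hP, h1, -⟩ := mapRingHom_epsilon (L := L) H K
  rw [hP, mul_assoc, h1, mapRingHom_hat_mul_charIdem hKH, if_pos hψ.ge]
  intro M hM hle
  refine hM.prop.1.not_ge fun x hx => ?_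
  rw [hψ] at hle
  exact hle (x := ⟨x, hM.prop.2.1 hx⟩) hx

theorem mapRingHom_epsilon_mul_charIdem_of_ker_ne {K : Subgroup G} (hKH : K ≤ H) (ψ : H →* Lˣ)
    (hle : K.subgroupOf H ≤ ψ.ker) (hψ : ψ.ker ≠ K.subgroupOf H) :
    MonoidAlgebra.mapRingHom G (Rat.castHom L) (epsilon H K) * charIdem ψ = 0 := by
  classical
  obtain ⟨P, hP, -, h2⟩ := mapRingHom_epsilon (L := L) H K
  rw [hP, mul_assoc, h2, mul_zero]
  have hsub : (ψ.ker.map H.subtype).subgroupOf H = ψ.ker :=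
    Subgroup.comap_map_eq_self_of_injective H.subtype_injective _
  have hnb : NormalBetween H K (ψ.ker.map H.subtype) := by
    refine ⟨lt_of_le_of_ne ?_ ?_, Subgroup.map_subtype_le _, hsub.symm ▸ ψ.normal_ker⟩
    · intro x hx
      exact ⟨⟨x, hKH hx⟩, hle hx, rfl⟩
    · intro h
      exact hψ (by conv_rhs => rw [h, hsub])
  obtain ⟨M, hM, hMmin⟩ :=
    (Set.toFinite {M : Subgroup G | NormalBetween H K M}).exists_le_minimal hnb
  exact ⟨M, hMmin, fun x hx => hsub.le (hM hx)⟩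

end CharIdem

/-! ### Characters with a given kernel -/

section Characters

variable {L G : Type*} [Field L] [Group G] {H K : Subgroup G} {h : G}

theorem exists_zpow_of_isGenerator (hh : IsGenerator H K h) {χ : H →* Lˣ}
    (hχ : K.subgroupOf H ≤ χ.ker) (x : H) : ∃ n : ℤ, χ x = χ ⟨h, hh.1⟩ ^ n := by
  obtain ⟨n, hn⟩ := hh.2 x x.2
  refine ⟨n, ?_⟩
  have : x * (⟨h, hh.1⟩ ^ n)⁻¹ ∈ χ.ker := hχ (by simpa [Subgroup.mem_subgroupOf] using hn)
  rw [MonoidHom.mem_ker, map_mul, map_inv, map_zpow, mul_inv_eq_one] at this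
  exact this

theorem char_ext (hh : IsGenerator H K h) {φ ψ : H →* Lˣ} (hφ : K.subgroupOf H ≤ φ.ker)
    (hψ : K.subgroupOf H ≤ ψ.ker) (heq : φ ⟨h, hh.1⟩ = ψ ⟨h, hh.1⟩) : φ = ψ := by
  ext x
  obtain ⟨n, hn⟩ := hh.2 x x.2
  have h1 : x * (⟨h, hh.1⟩ ^ n)⁻¹ ∈ K.subgroupOf H := by simpa [Subgroup.mem_subgroupOf] using hn
  have h2 := hφ h1
  have h3 := hψ h1
  rw [MonoidHom.mem_ker, map_mul, map_inv, map_zpow, mul_inv_eq_one] at h2 h3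
  rw [h2, h3, heq]

theorem le_ker_pow {χ : H →* Lˣ} (hχ : K.subgroupOf H ≤ χ.ker) (n : ℕ) :
    K.subgroupOf H ≤ (χ ^ n).ker := by
  intro x hx
  rw [MonoidHom.mem_ker, MonoidHom.pow_apply, hχ hx, one_pow]

theorem orderOf_apply_generator (hh : IsGenerator H K h) {χ : H →* Lˣ}
    (hχ : χ.ker = K.subgroupOf H) : orderOf (χ ⟨h, hh.1⟩) = K.relIndex H := by
  have : χ.range = Subgroup.zpowers (χ ⟨h, hh.1⟩) := by
    ext y
    constructor
    · rintro ⟨x, rfl⟩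
      obtain ⟨n, hn⟩ := exists_zpow_of_isGenerator hh hχ.ge x
      exact ⟨n, hn.symm⟩
    · rintro ⟨n, rfl⟩
      exact ⟨⟨h, hh.1⟩ ^ n, map_zpow ..⟩
  rw [← Nat.card_zpowers, ← this, ← Subgroup.index_ker, hχ, Subgroup.relIndex]

theorem apply_pow_relIndex (hh : IsGenerator H K h) {χ : H →* Lˣ}
    (hχ : χ.ker = K.subgroupOf H) (x : H) : χ x ^ K.relIndex H = 1 := by
  obtain ⟨n, hn⟩ := exists_zpow_of_isGenerator hh hχ.ge x
  rw [hn, ← orderOf_apply_generator hh hχ, ← zpow_natCast, zpow_comm, zpow_natCast,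
    pow_orderOf_eq_one, one_zpow]

theorem char_pow_eq_pow_iff (hh : IsGenerator H K h) {χ : H →* Lˣ}
    (hχ : χ.ker = K.subgroupOf H) {m n : ℕ} : χ ^ m = χ ^ n ↔ m ≡ n [MOD K.relIndex H] := by
  rw [← orderOf_apply_generator hh hχ, ← pow_eq_pow_iff_modEq]
  exact ⟨fun h' => congrArg (fun f => f ⟨h, hh.1⟩) h', fun h' =>
    char_ext hh (le_ker_pow hχ.ge m) (le_ker_pow hχ.ge n) h'⟩

variable [Finite G]

theorem char_pow_val_eq_iff (hh : IsGenerator H K h) {χ : H →* Lˣ}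
    (hχ : χ.ker = K.subgroupOf H) {n : ℕ} {r : ZMod (K.relIndex H)} :
    χ ^ n = χ ^ r.val ↔ (n : ZMod (K.relIndex H)) = r := by
  rw [char_pow_eq_pow_iff hh hχ, ← ZMod.natCast_eq_natCast_iff, ZMod.natCast_zmod_val]

theorem char_pow_val_pow_val (hh : IsGenerator H K h) {χ : H →* Lˣ}
    (hχ : χ.ker = K.subgroupOf H) (r s : ZMod (K.relIndex H)) :
    (χ ^ r.val) ^ s.val = χ ^ (r * s).val := by
  have : (χ ^ r.val) ^ s.val = χ ^ (r.val * s.val) :=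
    MonoidHom.ext fun x => by simp only [MonoidHom.pow_apply, pow_mul]
  rw [this, char_pow_val_eq_iff hh hχ]
  simp

theorem ker_pow_eq_iff (hh : IsGenerator H K h) {χ : H →* Lˣ}
    (hχ : χ.ker = K.subgroupOf H) {n : ℕ} :
    (χ ^ n).ker = K.subgroupOf H ↔ n.Coprime (K.relIndex H) := by
  have hpos : 0 < K.relIndex H := Nat.pos_of_ne_zero (NeZero.ne _)
  constructor
  · intro hn
    have h1 := orderOf_apply_generator hh hn
    have hfin : IsOfFinOrder (χ ⟨h, hh.1⟩) :=
      orderOf_pos_iff.1 ((orderOf_apply_generator hh hχ).symm ▸ hpos)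
    rw [MonoidHom.pow_apply, hfin.orderOf_pow, orderOf_apply_generator hh hχ] at h1
    have h2 : (K.relIndex H).gcd n * K.relIndex H = K.relIndex H := by
      conv_lhs => rw [← h1]
      rw [h1]
      conv_rhs => rw [← Nat.mul_div_cancel' (Nat.gcd_dvd_left (K.relIndex H) n), h1]
    exact Nat.Coprime.symm (Nat.eq_of_mul_eq_mul_right hpos (h2.trans (one_mul _).symm))
  · intro hn
    refine le_antisymm (fun x hx => ?_) (le_ker_pow hχ.ge n)
    rw [← hχ, MonoidHom.mem_ker]
    have h1 : χ x ^ n = 1 := hx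
    have := pow_gcd_eq_one.2 ⟨h1, apply_pow_relIndex hh hχ x⟩
    rwa [hn.gcd_eq_one, pow_one] at this

theorem ker_pow_unit (hh : IsGenerator H K h) {χ : H →* Lˣ}
    (hχ : χ.ker = K.subgroupOf H) (r : (ZMod (K.relIndex H))ˣ) :
    (χ ^ (r : ZMod (K.relIndex H)).val).ker = K.subgroupOf H :=
  (ker_pow_eq_iff hh hχ).2 (ZMod.val_coe_unit_coprime r)

/-- The characters of `H` with kernel `K` form a torsor under the units of `ℤ / [H:K]ℤ`. -/
theorem exists_unit_pow_eq (hh : IsGenerator H K h) {χ ψ : H →* Lˣ}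
    (hχ : χ.ker = K.subgroupOf H) (hψ : ψ.ker = K.subgroupOf H) :
    ∃ r : (ZMod (K.relIndex H))ˣ, ψ = χ ^ (r : ZMod (K.relIndex H)).val := by
  have hprim : IsPrimitiveRoot (χ ⟨h, hh.1⟩) (K.relIndex H) :=
    orderOf_apply_generator hh hχ ▸ IsPrimitiveRoot.orderOf _
  obtain ⟨i, -, hi⟩ := (IsPrimitiveRoot.coe_units_iff.2 hprim).eq_pow_of_pow_eq_one
    (ξ := (ψ ⟨h, hh.1⟩ : L))
    (by rw [← Units.val_pow_eq_pow_val, apply_pow_relIndex hh hψ, Units.val_one])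
  have h1 : ψ = χ ^ i := char_ext hh hψ.ge (le_ker_pow hχ.ge i) (Units.ext (by simpa using hi.symm))
  have hc : i.Coprime (K.relIndex H) := (ker_pow_eq_iff hh hχ).1 (h1 ▸ hψ)
  refine ⟨ZMod.unitOfCoprime i hc, h1.trans ?_⟩
  rw [char_pow_val_eq_iff hh hχ, ZMod.coe_unitOfCoprime]

theorem char_pow_unit_injective (hh : IsGenerator H K h) {χ : H →* Lˣ}
    (hχ : χ.ker = K.subgroupOf H) : Function.Injective
      fun r : (ZMod (K.relIndex H))ˣ => χ ^ (r : ZMod (K.relIndex H)).val := by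
  intro r s hrs
  have := (char_pow_val_eq_iff hh hχ).1 hrs
  rw [ZMod.natCast_zmod_val] at this
  exact Units.ext this

theorem epsilon_mul_hat (hn : H ≤ Subgroup.normalizer (K : Set G)) :
    epsilon H K * hat K = epsilon H K := by
  obtain ⟨comm, heps⟩ := exists_epsilon_eq H K
  have hK : hat K * hat K = hat K := by
    refine mapRingHom_injective (RingHom.injective (Rat.castHom ℚ)) ?_
    rw [map_mul, mapRingHom_hat, charIdem_mul_self]
  have hcomm : ∀ M ∈ minimalNormals H K, Commute (hat K) (1 - hat M) := by
    intro M hM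
    refine (Commute.one_right _).sub_right ?_
    have := Fintype.ofFinite M
    conv => arg 2; rw [hat, finsum_eq_sum_of_fintype]
    refine (Commute.sum_right _ _ _ fun m _ => ?_).smul_right _
    exact (of_mul_hat K (m : G) (Subgroup.mem_normalizer_iff.1
      (hn ((mem_minimalNormals.1 hM).prop.2.1 m.2)))).symm
  rw [heps, mul_assoc, ← (Finset.noncommProd_commute _ _ _ _ hcomm).eq, ← mul_assoc, hK]

variable [CharZero L]

/-- `K̂` is the sum of the idempotents of the characters of `H / K`. -/
theorem mapRingHom_hat_eq_sum (hKH : K ≤ H) (hh : IsGenerator H K h) {χ : H →* Lˣ}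
    (hχ : χ.ker = K.subgroupOf H) :
    MonoidAlgebra.mapRingHom G (Rat.castHom L) (hat K) =
      ∑ j ∈ Finset.range (K.relIndex H), charIdem (χ ^ j) := by
  classical
  ext g
  rw [mapRingHom_hat, coeff_charIdem, MonoidAlgebra.coeff_sum, Finsupp.finsetSum_apply]
  simp only [coeff_charIdem]
  have hker : ∀ hg : g ∈ H, χ ⟨g, hg⟩ = 1 ↔ g ∈ K := fun hg => by
    rw [← MonoidHom.mem_ker, hχ, Subgroup.mem_subgroupOf]
  by_cases hgH : g ∈ H
  · simp only [dif_pos hgH]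
    by_cases hgK : g ∈ K
    · have hcard : Nat.card K * K.relIndex H = Nat.card H := by
        rw [← (K.subgroupOf H).card_mul_index,
          Nat.card_congr (Subgroup.subgroupOfEquivOfLe hKH).toEquiv, Subgroup.relIndex]
      have hk : (K.relIndex H : L) ≠ 0 := Nat.cast_ne_zero.2 (NeZero.ne _)
      simp [dif_pos hgK, (hker hgH).2 hgK, ← hcard, hk]
    · rw [dif_neg hgK, ← Finset.mul_sum]
      have hne : (((χ ⟨g, hgH⟩)⁻¹ : Lˣ) : L) - 1 ≠ 0 := by
        rw [sub_ne_zero, Ne, Units.val_eq_one, inv_eq_one, hker hgH]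
        exact hgK
      have : ∑ j ∈ Finset.range (K.relIndex H), ((((χ ⟨g, hgH⟩)⁻¹ : Lˣ) : L)) ^ j = 0 := by
        refine (mul_eq_zero.1 ?_).resolve_left hne
        rw [mul_geom_sum, ← Units.val_pow_eq_pow_val, inv_pow, apply_pow_relIndex hh hχ]
        simp
      rw [← mul_zero (Nat.card H : L)⁻¹, ← this]
      simp
  · rw [dif_neg fun hgK => hgH (hKH hgK)]
    simp [hgH]

/-- `ε(H, K)` is the sum of the idempotents of the characters of `H` with kernel `K`. -/
theorem mapRingHom_epsilon_eq_sum (hKH : K ≤ H) (hn : H ≤ Subgroup.normalizer (K : Set G))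
    (hh : IsGenerator H K h) {χ : H →* Lˣ} (hχ : χ.ker = K.subgroupOf H) :
    MonoidAlgebra.mapRingHom G (Rat.castHom L) (epsilon H K) =
      ∑ r : (ZMod (K.relIndex H))ˣ, charIdem (χ ^ (r : ZMod (K.relIndex H)).val) := by
  classical
  rw [← epsilon_mul_hat hn, map_mul, mapRingHom_hat_eq_sum hKH hh hχ, Finset.mul_sum]
  have hinj : Function.Injective fun r : (ZMod (K.relIndex H))ˣ => (r : ZMod (K.relIndex H)).val :=
    fun r s hrs => Units.ext (ZMod.val_injective _ hrs)
  rw [← Finset.sum_image (f := fun j => charIdem (χ ^ j)) (fun r _ s _ hrs => hinj hrs)]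
  refine (Finset.sum_subset_zero_on_sdiff ?_ ?_ ?_).symm
  · intro j hj
    obtain ⟨r, -, rfl⟩ := Finset.mem_image.1 hj
    exact Finset.mem_range.2 (ZMod.val_lt _)
  · intro j hj
    rw [Finset.mem_sdiff, Finset.mem_range, Finset.mem_image] at hj
    refine mapRingHom_epsilon_mul_charIdem_of_ker_ne hKH _ (le_ker_pow hχ.ge j) fun hker => ?_
    have hc := (ker_pow_eq_iff hh hχ).1 hker
    exact hj.2 ⟨ZMod.unitOfCoprime j hc, Finset.mem_univ _, by
      rw [ZMod.coe_unitOfCoprime, ZMod.val_natCast, Nat.mod_eq_of_lt hj.1]⟩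
  · intro j hj
    obtain ⟨r, -, rfl⟩ := Finset.mem_image.1 hj
    exact (mapRingHom_epsilon_mul_charIdem_of_ker_eq hKH _ (ker_pow_unit hh hχ r)).symm

end Characters

/-! ### Strong Shoda pairs -/

section ShodaPair

variable {G L : Type*} [Group G] [Field L] {H K : Subgroup G} {h : G}

theorem conjChar_apply_mk (g : Subgroup.normalizer (H : Set G)) (χ : H →* Lˣ) (x : G) (hx : x ∈ H)
    (hx' : (g : G) * x * (g : G)⁻¹ ∈ H) :
    conjChar g χ ⟨x, hx⟩ = χ ⟨(g : G) * x * (g : G)⁻¹, hx'⟩ := rfl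

theorem conjChar_pow (g : Subgroup.normalizer (H : Set G)) (χ : H →* Lˣ) (n : ℕ) :
    conjChar g (χ ^ n) = conjChar g χ ^ n := rfl

theorem ker_conjChar {g : Subgroup.normalizer (H : Set G)}
    (hg : (g : G) ∈ Subgroup.normalizer (K : Set G)) {χ : H →* Lˣ}
    (hχ : χ.ker = K.subgroupOf H) : (conjChar g χ).ker = K.subgroupOf H := by
  ext ⟨x, hx⟩
  rw [MonoidHom.mem_ker, conjChar_apply_mk g χ x hx ((Subgroup.mem_normalizer_iff.1 g.2 x).1 hx),
    ← MonoidHom.mem_ker, hχ, Subgroup.mem_subgroupOf, Subgroup.mem_subgroupOf]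
  exact (Subgroup.mem_normalizer_iff.1 hg x).symm

variable [Finite G]

theorem IsStrongShodaPair.normalizer_le (hp : IsStrongShodaPair H K) :
    Subgroup.normalizer (K : Set G) ≤ Subgroup.normalizer (H : Set G) :=
  (Subgroup.normal_subgroupOf_iff_le_normalizer hp.le_normalizer).1 hp.normal

/-- By maximality of `H / K` among the abelian subgroups of `N_G(K) / K`, an element of `N_G(K)`
that acts trivially on `H / K` lies in `H`. -/
theorem IsStrongShodaPair.mem_of_commutator_mem (hp : IsStrongShodaPair H K) {g : G}
    (hg : g ∈ Subgroup.normalizer (K : Set G)) (hc : ∀ x ∈ H, (x * g)⁻¹ * (g * x) ∈ K) :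
    g ∈ H := by
  set N := Subgroup.normalizer (K : Set G)
  let π : N →* N ⧸ K.subgroupOf N := QuotientGroup.mk' (K.subgroupOf N)
  have hcomm : ∀ a ∈ quot H K, ∀ b ∈ quot H K, a * b = b * a := by
    have := hp.maximal_abelian.prop
    exact fun a ha b hb => setLike_mul_comm ha hb
  have hcg : ∀ a ∈ quot H K, a * π ⟨g, hg⟩ = π ⟨g, hg⟩ * a := by
    rintro _ ⟨x, hx, rfl⟩
    change π x * π _ = π _ * π x
    rw [← map_mul, ← map_mul]
    exact QuotientGroup.eq.2 (hc x hx)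
  have hab : IsMulCommutative (Subgroup.closure ((quot H K : Set (N ⧸ K.subgroupOf N)) ∪
      {π ⟨g, hg⟩})) := by
    refine Subgroup.isMulCommutative_closure ?_
    rintro a (ha | rfl) b (hb | rfl)
    · exact hcomm a ha b hb
    · exact hcg a ha
    · exact (hcg b hb).symm
    · rfl
  have hmem : π ⟨g, hg⟩ ∈ quot H K :=
    hp.maximal_abelian.le_of_ge hab (fun a ha => Subgroup.subset_closure (Or.inl ha))
      (Subgroup.subset_closure (Or.inr rfl))
  obtain ⟨y, hy, hyg⟩ := hmem
  have h1 : (y : G)⁻¹ * g ∈ K := (QuotientGroup.eq (s := K.subgroupOf N)).1 hyg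
  have h2 := H.mul_mem hy (hp.le h1)
  simpa using h2

/-- `N_G(K)` acts on the cyclic group `H / K` through a homomorphism to the units of `ℤ / [H:K]ℤ`,
whose image is `U_(H,K)`. It is expressed through the action on a character with kernel `K`, and
`N_G(K)` is written as `N_G(H) ∩ N_G(K)`, the group on which `stab` is defined. -/
theorem exists_conjHom (hp : IsStrongShodaPair H K) (hh : IsGenerator H K h) {χ : H →* Lˣ}
    (hχ : χ.ker = K.subgroupOf H) :
    ∃ ρ : (Subgroup.normalizer (H : Set G) ⊓ Subgroup.normalizer (K : Set G) : Subgroup G) →*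
        (ZMod (K.relIndex H))ˣ,
      (∀ g, conjChar (Subgroup.inclusion inf_le_left g)⁻¹ χ =
        χ ^ (ρ g : ZMod (K.relIndex H)).val) ∧ (ρ.range : Set _) = conjUnits H K h := by
  have hker : ∀ g : (Subgroup.normalizer (H : Set G) ⊓ Subgroup.normalizer (K : Set G) :
      Subgroup G), (conjChar (Subgroup.inclusion inf_le_left g)⁻¹ χ).ker = K.subgroupOf H :=
    fun g => ker_conjChar (g := (Subgroup.inclusion inf_le_left g)⁻¹)
      (Subgroup.inv_mem _ g.2.2) hχ
  have hex : ∀ g : (Subgroup.normalizer (H : Set G) ⊓ Subgroup.normalizer (K : Set G) :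
      Subgroup G), ∃ r : (ZMod (K.relIndex H))ˣ, conjChar (Subgroup.inclusion inf_le_left g)⁻¹ χ =
        χ ^ (r : ZMod (K.relIndex H)).val := fun g =>
    exists_unit_pow_eq hh hχ (hker g)
  choose f hf using hex
  have huniq : ∀ g (r : (ZMod (K.relIndex H))ˣ), conjChar (Subgroup.inclusion inf_le_left g)⁻¹ χ =
      χ ^ (r : ZMod (K.relIndex H)).val → f g = r := fun g r hr =>
    char_pow_unit_injective hh hχ ((hf g).symm.trans hr)
  refine ⟨MonoidHom.mk' f fun a b => huniq _ _ ?_, hf, ?_⟩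
  · rw [map_mul, mul_inv_rev, conjChar_mul, Function.comp_apply, hf b, conjChar_pow, hf a,
      char_pow_val_pow_val hh hχ, Units.val_mul]
  · have key : ∀ (g : (Subgroup.normalizer (H : Set G) ⊓ Subgroup.normalizer (K : Set G) :
        Subgroup G)) (r : (ZMod (K.relIndex H))ˣ), f g = r ↔
        (g : G)⁻¹ * h * g * (h ^ (r : ZMod (K.relIndex H)).val)⁻¹ ∈ K := by
      intro g r
      have hmem : (g : G)⁻¹ * h * g ∈ H := by
        have := (Subgroup.mem_normalizer_iff.1 (Subgroup.inv_mem _ g.2.1) h).1 hh.1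
        simpa using this
      have h1 : f g = r ↔ conjChar (Subgroup.inclusion inf_le_left g)⁻¹ χ =
          χ ^ (r : ZMod (K.relIndex H)).val := ⟨fun h' => h' ▸ hf g, huniq g r⟩
      have h2 : conjChar (Subgroup.inclusion inf_le_left g)⁻¹ χ =
          χ ^ (r : ZMod (K.relIndex H)).val ↔
          χ ⟨(g : G)⁻¹ * h * g, hmem⟩ = χ ⟨h, hh.1⟩ ^ (r : ZMod (K.relIndex H)).val := by
        have h3 : conjChar (Subgroup.inclusion inf_le_left g)⁻¹ χ ⟨h, hh.1⟩ =
            χ ⟨(g : G)⁻¹ * h * g, hmem⟩ := by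
          rw [conjChar_apply_mk _ _ _ _ (by simpa using hmem)]
          congr 2
          simp
        rw [← h3]
        exact ⟨fun h' => by rw [h']; rfl, fun h' =>
          char_ext hh (hker g).ge (le_ker_pow hχ.ge _) h'⟩
      rw [h1, h2, ← mul_inv_eq_one, ← map_pow, ← map_inv, ← map_mul, ← MonoidHom.mem_ker, hχ]
      rfl
    ext r
    constructor
    · rintro ⟨g, hg⟩
      exact ⟨g, g.2.2, (key g r).1 hg⟩
    · rintro ⟨g, hg, hr⟩
      exact ⟨⟨g, hp.normalizer_le hg, hg⟩, (key _ r).2 hr⟩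

end ShodaPair

/-! ### Central idempotents below `e(G, H, K)` -/

section CharSum

variable {G L : Type*} [Group G] [Field L] {H K : Subgroup G} {h : G}

/-- The element `∑ e_(χ^r)`, `r` running over a set of units of `ℤ / [H:K]ℤ`. -/
def charSum (K : Subgroup G) (χ : H →* Lˣ) (S : Finset (ZMod (K.relIndex H))ˣ) :
    MonoidAlgebra L G :=
  ∑ r ∈ S, charIdem (χ ^ (r : ZMod (K.relIndex H)).val)

theorem charSum_singleton (χ : H →* Lˣ) (r : (ZMod (K.relIndex H))ˣ) :
    charSum K χ {r} = charIdem (χ ^ (r : ZMod (K.relIndex H)).val) :=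
  Finset.sum_singleton ..

variable [Finite G]

/-- Multiplying all exponents by a unit `u` amounts to replacing `χ` by `χ ^ u`. -/
theorem charSum_pow (hh : IsGenerator H K h) {χ : H →* Lˣ} (hχ : χ.ker = K.subgroupOf H)
    (u : (ZMod (K.relIndex H))ˣ) (S : Finset (ZMod (K.relIndex H))ˣ) :
    charSum K (χ ^ (u : ZMod (K.relIndex H)).val) S =
      charSum K χ (S.map (Equiv.mulLeft u).toEmbedding) := by
  simp only [charSum, Finset.sum_map, Equiv.toEmbedding_apply, Equiv.coe_mulLeft, Units.val_mul,
    char_pow_val_pow_val hh hχ]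

theorem conjBy_charSum (g : Subgroup.normalizer (H : Set G)) (χ : H →* Lˣ)
    (S : Finset (ZMod (K.relIndex H))ˣ) :
    conjBy (g : G) (charSum K χ S) = charSum K (conjChar g χ) S := by
  simp only [charSum, conjBy_sum, conjBy_charIdem, conjChar_pow]

theorem mapRingHom_charSum {L' : Type*} [Field L'] (σ : L →+* L') (χ : H →* Lˣ)
    (S : Finset (ZMod (K.relIndex H))ˣ) :
    MonoidAlgebra.mapRingHom G σ (charSum K χ S) =
      charSum K ((Units.map (σ : L →* L')).comp χ) S := by
  simp only [charSum, map_sum, mapRingHom_charIdem]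
  refine Finset.sum_congr rfl fun r _ => congrArg charIdem (MonoidHom.ext fun x => ?_)
  simp only [MonoidHom.comp_apply, MonoidHom.pow_apply, map_pow]

/-- If `S` is stable under `U_(H,K)`, then `charSum K χ S` is fixed by `N_G(K)`. -/
theorem conjBy_charSum_of_mem_normalizer (hp : IsStrongShodaPair H K) (hh : IsGenerator H K h)
    {χ : H →* Lˣ} (hχ : χ.ker = K.subgroupOf H) {S : Finset (ZMod (K.relIndex H))ˣ}
    (hS : ∀ u ∈ conjUnits H K h, ∀ r, u * r ∈ S ↔ r ∈ S) {g : G}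
    (hg : g ∈ Subgroup.normalizer (K : Set G)) : conjBy g (charSum K χ S) = charSum K χ S := by
  obtain ⟨ρ, hρ, hrange⟩ := exists_conjHom hp hh hχ
  let g' : (Subgroup.normalizer (H : Set G) ⊓ Subgroup.normalizer (K : Set G) : Subgroup G) :=
    ⟨g, hp.normalizer_le hg, hg⟩
  have h1 : conjChar (Subgroup.inclusion inf_le_left g') χ =
      χ ^ (ρ g'⁻¹ : ZMod (K.relIndex H)).val := by
    rw [← hρ, map_inv, inv_inv]
  have h2 := conjBy_charSum (K := K) (Subgroup.inclusion inf_le_left g') χ S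
  rw [h1, charSum_pow hh hχ] at h2
  refine h2.trans (congrArg _ ?_)
  have hu : (ρ g'⁻¹)⁻¹ ∈ conjUnits H K h := by
    rw [← hrange]
    exact ⟨g', by rw [map_inv, inv_inv]⟩
  ext r
  rw [← hS _ hu, Finset.mem_map_equiv, Equiv.mulLeft_symm_apply]

variable [CharZero L]

open Classical in
theorem charSum_mul_charSum (hh : IsGenerator H K h) {χ : H →* Lˣ} (hχ : χ.ker = K.subgroupOf H)
    (S T : Finset (ZMod (K.relIndex H))ˣ) :
    charSum K χ S * charSum K χ T = charSum K χ (S ∩ T) := by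
  have key : ∀ r s : (ZMod (K.relIndex H))ˣ, charIdem (χ ^ (r : ZMod (K.relIndex H)).val) *
      charIdem (χ ^ (s : ZMod (K.relIndex H)).val) =
      if r = s then charIdem (χ ^ (r : ZMod (K.relIndex H)).val) else 0 := by
    intro r s
    split_ifs with hrs
    · rw [hrs, charIdem_mul_self]
    · exact charIdem_mul_of_ne fun h' => hrs (char_pow_unit_injective hh hχ h')
  simp only [charSum, Finset.sum_mul_sum, key, Finset.sum_ite_eq, Finset.sum_ite_mem]

theorem charSum_injective (hh : IsGenerator H K h) {χ : H →* Lˣ} (hχ : χ.ker = K.subgroupOf H) :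
    Function.Injective (charSum (L := L) K χ) := by
  classical
  have key : ∀ S T, charSum K χ S = charSum K χ T → S ⊆ T := by
    intro S T hST r hr
    by_contra hrT
    have h1 := congrArg (· * charSum K χ {r}) hST
    simp only [charSum_mul_charSum hh hχ] at h1
    rw [Finset.inter_singleton_of_mem hr, Finset.inter_singleton_of_notMem hrT,
      charSum_singleton] at h1
    exact charIdem_ne_zero _ h1
  exact fun S T hST => (key S T hST).antisymm (key T S hST.symm)

theorem charSum_univ (hp : IsStrongShodaPair H K) (hh : IsGenerator H K h) {χ : H →* Lˣ}
    (hχ : χ.ker = K.subgroupOf H) : charSum K χ Finset.univ =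
      MonoidAlgebra.mapRingHom G (Rat.castHom L) (epsilon H K) :=
  (mapRingHom_epsilon_eq_sum hp.le hp.le_normalizer hh hχ).symm

/-- As `ε(H, K)` is orthogonal to its conjugates under elements outside `N_G(K)`, the same
holds for the elements `charSum K χ S`, which are multiples of `ε(H, K)`. -/
theorem charSum_mul_conjBy_charSum (hp : IsStrongShodaPair H K) (hh : IsGenerator H K h)
    {χ : H →* Lˣ} (hχ : χ.ker = K.subgroupOf H) (S T : Finset (ZMod (K.relIndex H))ˣ) {g : G}
    (hg : g ∉ Subgroup.normalizer (K : Set G)) :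
    charSum K χ S * conjBy g (charSum K χ T) = 0 := by
  classical
  have h1 : charSum K χ Finset.univ * conjBy g (charSum K χ Finset.univ) = 0 := by
    rw [charSum_univ hp hh hχ, ← mapRingHom_conjBy, ← map_mul]
    exact (congrArg _ (hp.orthogonal g hg)).trans (map_zero _)
  rw [← Finset.inter_univ S, ← Finset.univ_inter T, ← charSum_mul_charSum hh hχ,
    ← charSum_mul_charSum hh hχ, conjBy_mul, mul_assoc, ← mul_assoc (charSum K χ Finset.univ), h1,
    zero_mul, mul_zero]

theorem isConjOrthogonal_charSum (hp : IsStrongShodaPair H K) (hh : IsGenerator H K h)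
    {χ : H →* Lˣ} (hχ : χ.ker = K.subgroupOf H) {S : Finset (ZMod (K.relIndex H))ˣ}
    (hS : ∀ u ∈ conjUnits H K h, ∀ r, u * r ∈ S ↔ r ∈ S) : IsConjOrthogonal (charSum K χ S) where
  idem := by
    classical
    rw [charSum_mul_charSum hh hχ, Finset.inter_self]
  orth g := by
    by_cases hg : g ∈ Subgroup.normalizer (K : Set G)
    · exact Or.inl (conjBy_charSum_of_mem_normalizer hp hh hχ hS hg)
    · exact Or.inr (charSum_mul_conjBy_charSum hp hh hχ S S hg)

theorem isConjOrthogonal_epsilon (hp : IsStrongShodaPair H K) (hh : IsGenerator H K h)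
    {χ : H →* Lˣ} (hχ : χ.ker = K.subgroupOf H) : IsConjOrthogonal (epsilon H K) := by
  refine IsConjOrthogonal.of_mapRingHom (Rat.castHom L).injective ?_
  rw [← charSum_univ hp hh hχ]
  exact isConjOrthogonal_charSum hp hh hχ fun _ _ _ => by simp

/-- The idempotent of a character `ψ` of `H` with kernel `K` has corner ring `L`: off `H`, the
group elements are annihilated from both sides. -/
theorem charIdem_mul_of_mul_charIdem (hp : IsStrongShodaPair H K) (hh : IsGenerator H K h)
    {ψ : H →* Lˣ} (hψ : ψ.ker = K.subgroupOf H) {g : G} (hg : g ∉ H) :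
    charIdem ψ * MonoidAlgebra.of L G g * charIdem ψ = 0 := by
  have hconj : charIdem ψ * MonoidAlgebra.of L G g * charIdem ψ =
      charIdem ψ * conjBy g⁻¹ (charIdem ψ) * MonoidAlgebra.of L G g := by
    rw [conjBy, inv_inv]
    simp only [mul_assoc, of_inv_mul_of, mul_one]
  rw [hconj]
  by_cases hgN : g ∈ Subgroup.normalizer (K : Set G)
  · let g' : Subgroup.normalizer (H : Set G) := ⟨g, hp.normalizer_le hgN⟩
    rw [show g⁻¹ = ((g'⁻¹ : Subgroup.normalizer (H : Set G)) : G) from rfl, conjBy_charIdem,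
      charIdem_mul_of_ne, zero_mul]
    intro heq
    refine hg (hp.mem_of_commutator_mem hgN fun x hx => ?_)
    have hx' : g⁻¹ * x * g ∈ H := by
      simpa using (Subgroup.mem_normalizer_iff''.1 g'.2 x).1 hx
    have h1 : ψ ⟨x, hx⟩ = ψ ⟨g⁻¹ * x * g, hx'⟩ := by
      conv_lhs => rw [heq]
      rw [conjChar_apply_mk _ _ _ _ (by simpa [g'] using hx')]
      congr 2
      simp [g']
    have h2 : (⟨g⁻¹ * x * g, hx'⟩⁻¹ * ⟨x, hx⟩ : H) ∈ ψ.ker := by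
      rw [MonoidHom.mem_ker, map_mul, map_inv, h1, inv_mul_cancel]
    rw [hψ, Subgroup.mem_subgroupOf] at h2
    have h3 : (g⁻¹ * x * g)⁻¹ * x ∈ K := h2
    simpa [mul_assoc] using h3
  · have hgN' : g⁻¹ ∉ Subgroup.normalizer (K : Set G) := fun h' => hgN (by
      simpa using Subgroup.inv_mem _ h')
    obtain ⟨r, hr⟩ := exists_unit_pow_eq hh hψ hψ
    rw [hr, ← charSum_singleton, charSum_mul_conjBy_charSum hp hh hψ _ _ hgN', zero_mul]

theorem exists_charIdem_mul_mul_charIdem (hp : IsStrongShodaPair H K) (hh : IsGenerator H K h)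
    {ψ : H →* Lˣ} (hψ : ψ.ker = K.subgroupOf H) (a : MonoidAlgebra L G) :
    ∃ c : L, charIdem ψ * a * charIdem ψ = c • charIdem ψ := by
  induction a using MonoidAlgebra.induction_on with
  | of g =>
    by_cases hg : g ∈ H
    · refine ⟨ψ ⟨g, hg⟩, ?_⟩
      rw [mul_assoc, of_mul_charIdem ψ ⟨g, hg⟩, mul_smul_comm, charIdem_mul_self]
    · exact ⟨0, by rw [charIdem_mul_of_mul_charIdem hp hh hψ hg, zero_smul]⟩
  | add a b ha hb =>
    obtain ⟨c, hc⟩ := ha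
    obtain ⟨d, hd⟩ := hb
    exact ⟨c + d, by rw [mul_add, add_mul, hc, hd, add_smul]⟩
  | smul r a ha =>
    obtain ⟨c, hc⟩ := ha
    exact ⟨r * c, by rw [mul_smul_comm, smul_mul_assoc, hc, smul_smul]⟩

/-- As its corner ring is a field, the idempotent of a character with kernel `K` is fixed or
annihilated by each central idempotent. -/
theorem centralIdempotent_mul_charIdem (hp : IsStrongShodaPair H K) (hh : IsGenerator H K h)
    {ψ : H →* Lˣ} (hψ : ψ.ker = K.subgroupOf H) {z : MonoidAlgebra L G}
    (hz : z ∈ centralIdempotents (MonoidAlgebra L G)) :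
    z * charIdem ψ = 0 ∨ z * charIdem ψ = charIdem ψ := by
  obtain ⟨c, hc⟩ := exists_charIdem_mul_mul_charIdem hp hh hψ z
  rw [Semigroup.mem_center_iff.1 hz.1, mul_assoc, charIdem_mul_self] at hc
  have h1 : z * (z * charIdem ψ) = z * charIdem ψ := by rw [← mul_assoc, hz.2.eq]
  rw [hc, mul_smul_comm, hc, smul_smul] at h1
  rw [hc]
  have h2 : (c * c - c) • charIdem ψ = 0 := by rw [sub_smul, h1, sub_self]
  have h3 : c * (c - 1) = 0 := by
    rw [mul_sub, mul_one]
    exact (smul_eq_zero.1 h2).resolve_right (charIdem_ne_zero ψ)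
  rcases mul_eq_zero.1 h3 with h4 | h4
  · exact Or.inl (by rw [h4, zero_smul])
  · exact Or.inr (by rw [sub_eq_zero.1 h4, one_smul])

end CharSum

section Key

variable {G : Type*} [Group G] [Finite G] {H K : Subgroup G} {h : G}
variable (F : Type*) [Field F] [NumberField F]

/-- The image of `e(G, H, K)` in `FG`. -/
def eOver (H K : Subgroup G) : MonoidAlgebra F G :=
  MonoidAlgebra.mapRingHom G (Rat.castHom F) (e H K)

variable {F}

theorem mapRingHom_algebraMap_eOver {L : Type*} [Field L] [CharZero L] [Algebra F L] :
    MonoidAlgebra.mapRingHom G (algebraMap F L) (eOver F H K) =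
      conjSum (MonoidAlgebra.mapRingHom G (Rat.castHom L) (epsilon H K)) := by
  rw [← mapRingHom_conjSum (Rat.castHom L).injective, eOver, ← RingHom.comp_apply,
    ← MonoidAlgebra.mapRingHom_comp,
    Subsingleton.elim ((algebraMap F L).comp (Rat.castHom F)) (Rat.castHom L)]
  rfl

/-- An automorphism `σ` of `F(ζ_k)` raises a character with values in the `k`-th roots of unity to
the power given by the image of `σ` in `I_k(F)`. -/
theorem map_comp_char (hh : IsGenerator H K h)
    {χ : H →* (CyclotomicField (K.relIndex H) F)ˣ} (hχ : χ.ker = K.subgroupOf H)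
    (σ : CyclotomicField (K.relIndex H) F ≃ₐ[F] CyclotomicField (K.relIndex H) F) :
    (Units.map (σ : CyclotomicField (K.relIndex H) F →* CyclotomicField (K.relIndex H) F)).comp χ =
      χ ^ ((IsCyclotomicExtension.zeta_spec (K.relIndex H) F
        (CyclotomicField (K.relIndex H) F)).autToPow F σ : ZMod (K.relIndex H)).val := by
  have hz := IsCyclotomicExtension.zeta_spec (K.relIndex H) F (CyclotomicField (K.relIndex H) F)
  ext x
  obtain ⟨i, -, hi⟩ := hz.eq_pow_of_pow_eq_one (ξ := (χ x : CyclotomicField (K.relIndex H) F))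
    (by rw [← Units.val_pow_eq_pow_val, apply_pow_relIndex hh hχ, Units.val_one])
  rw [MonoidHom.comp_apply, MonoidHom.pow_apply, Units.coe_map, Units.val_pow_eq_pow_val, ← hi,
    ← pow_mul, mul_comm, pow_mul, hz.autToPow_spec F σ]
  exact map_pow σ _ _

section Extension

variable {L : Type*} [Field L] [CharZero L] [Algebra F L]

theorem mapRingHom_algebraMap_eOver_eq_conjSum (hp : IsStrongShodaPair H K)
    (hh : IsGenerator H K h) {χ : H →* Lˣ} (hχ : χ.ker = K.subgroupOf H) :
    MonoidAlgebra.mapRingHom G (algebraMap F L) (eOver F H K) =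
      conjSum (charSum K χ Finset.univ) := by
  rw [charSum_univ hp hh hχ, mapRingHom_algebraMap_eOver]

/-- A Galois-invariant `charSum` has coefficients in the base field. -/
theorem exists_mapRingHom_eq_charSum [FiniteDimensional F L] [IsGalois F L]
    (hh : IsGenerator H K h) {χ : H →* Lˣ}
    (hχ : χ.ker = K.subgroupOf H) {S : Finset (ZMod (K.relIndex H))ˣ}
    (hσ : ∀ σ : L ≃ₐ[F] L, ∃ u : (ZMod (K.relIndex H))ˣ, (∀ r, u * r ∈ S ↔ r ∈ S) ∧
      (Units.map (σ : L →* L)).comp χ = χ ^ (u : ZMod (K.relIndex H)).val) :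
    ∃ w, MonoidAlgebra.mapRingHom G (algebraMap F L) w = charSum K χ S := by
  have hrange : charSum K χ S ∈
      Set.range (MonoidAlgebra.map (M := G) (algebraMap F L : F →+ L)) := by
    rw [MonoidAlgebra.range_map]
    intro g
    refine (IsGalois.mem_range_algebraMap_iff_fixed (F := F) (E := L) _).2 fun σ => ?_
    obtain ⟨u, hu, hσu⟩ := hσ σ
    have h1 : MonoidAlgebra.mapRingHom G (σ : L →+* L) (charSum K χ S) = charSum K χ S := by
      rw [mapRingHom_charSum]
      refine (congrArg (fun ψ => charSum K ψ S) hσu).trans ?_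
      rw [charSum_pow hh hχ]
      congr 1
      ext r
      rw [Finset.mem_map_equiv, Equiv.mulLeft_symm_apply, ← hu, mul_inv_cancel_left]
    conv_rhs => rw [← h1]
    rw [MonoidAlgebra.coeff_mapRingHom]
    rfl
  exact hrange

/-- If `FG` has no central idempotents strictly between `0` and `e(G, H, K)`, then no proper
subgroup of the units of `ℤ / [H:K]ℤ` contains `U_(H,K)` and all exponents of Galois
automorphisms: the sum of the conjugates of `∑ e_(χ^r)`, `r` running over such a subgroup, would be
a central idempotent of this kind. -/
theorem eq_top_of_centralIdempotents_trivial [FiniteDimensional F L] [IsGalois F L]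
    (hp : IsStrongShodaPair H K) (hh : IsGenerator H K h) {χ : H →* Lˣ}
    (hχ : χ.ker = K.subgroupOf H) (W : Subgroup (ZMod (K.relIndex H))ˣ)
    (hσ : ∀ σ : L ≃ₐ[F] L, ∃ u ∈ W,
      (Units.map (σ : L →* L)).comp χ = χ ^ (u : ZMod (K.relIndex H)).val)
    (hU : conjUnits H K h ⊆ W)
    (htriv : ∀ z ∈ centralIdempotents (MonoidAlgebra F G), z * eOver F H K = z →
      z = 0 ∨ z = eOver F H K) : W = ⊤ := by
  classical
  let ι : MonoidAlgebra F G →+* MonoidAlgebra L G := MonoidAlgebra.mapRingHom G (algebraMap F L)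
  have hι : Function.Injective ι := mapRingHom_injective (algebraMap F L).injective
  have heps : ι (eOver F H K) = conjSum (charSum K χ Finset.univ) :=
    mapRingHom_algebraMap_eOver_eq_conjSum hp hh hχ
  have horth := isConjOrthogonal_charSum hp hh hχ (S := Finset.univ) (by simp)
  let S : Finset (ZMod (K.relIndex H))ˣ := Finset.univ.filter (· ∈ W)
  have hSW : ∀ u ∈ W, ∀ r, u * r ∈ S ↔ r ∈ S := by
    intro u hu r
    simp only [S, Finset.mem_filter, Finset.mem_univ, true_and]
    exact W.mul_mem_cancel_left hu
  have hSU : ∀ u ∈ conjUnits H K h, ∀ r, u * r ∈ S ↔ r ∈ S := fun u hu => hSW u (hU hu)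
  obtain ⟨w, hw⟩ := exists_mapRingHom_eq_charSum hh hχ (S := S) fun σ => by
    obtain ⟨u, hu, hσu⟩ := hσ σ
    exact ⟨u, hSW u hu, hσu⟩
  have hwo : IsConjOrthogonal w :=
    IsConjOrthogonal.of_mapRingHom (f := algebraMap F L) (algebraMap F L).injective
      (hw.symm ▸ isConjOrthogonal_charSum hp hh hχ hSU)
  have hecen : eOver F H K ∈ Set.center (MonoidAlgebra F G) :=
    mapRingHom_mem_center _ (conjSum_mem_center _)
  have hmul : ∀ T, charSum K χ T * conjSum (charSum K χ Finset.univ) = charSum K χ T := by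
    intro T
    conv_lhs => rw [← Finset.inter_univ T, ← charSum_mul_charSum hh hχ, mul_assoc,
      horth.mul_conjSum, charSum_mul_charSum hh hχ, Finset.inter_univ]
  have hew : eOver F H K * w = w := by
    refine hι ?_
    rw [← Semigroup.mem_center_iff.1 hecen, map_mul, heps]
    exact hw ▸ hmul S
  have hz := htriv (conjSum w) hwo.conjSum_mem (by
    rw [Semigroup.mem_center_iff.1 hecen, mul_conjSum_eq_self_of_mem_center hecen hew])
  rcases hz with hz | hz
  · exfalso
    have h1 := hwo.mul_conjSum
    rw [hz, mul_zero] at h1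
    rw [← h1, map_zero] at hw
    have h2 : S = ∅ := charSum_injective hh hχ (hw.symm.trans Finset.sum_empty.symm)
    have h3 : (1 : (ZMod (K.relIndex H))ˣ) ∈ S :=
      Finset.mem_filter.2 ⟨Finset.mem_univ _, W.one_mem⟩
    rw [h2] at h3
    exact Finset.notMem_empty _ h3
  · -- The complementary sum `charSum K χ Sᶜ` annihilates `conjSum w`, but not `e(G, H, K)`.
    have h1 : charSum K χ Sᶜ * conjSum (charSum K χ S) = 0 := by
      refine mul_conjSum_eq_zero fun g => ?_
      by_cases hg : g ∈ Subgroup.normalizer (K : Set G)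
      · rw [conjBy_charSum_of_mem_normalizer hp hh hχ hSU hg, charSum_mul_charSum hh hχ,
          Finset.inter_comm, Finset.inter_compl]
        exact Finset.sum_empty
      · exact charSum_mul_conjBy_charSum hp hh hχ _ _ hg
    have h3 : conjSum (charSum K χ S) = conjSum (charSum K χ Finset.univ) := by
      rw [← heps, ← hw, ← hz]
      exact (mapRingHom_conjSum (algebraMap F L).injective w).symm
    have h2 := hmul Sᶜ
    rw [← h3, h1] at h2
    have h4 : Sᶜ = ∅ := charSum_injective hh hχ (h2.symm.trans Finset.sum_empty.symm)
    refine (Subgroup.eq_top_iff' _).2 fun u => ?_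
    have h5 : u ∈ S := (Finset.compl_eq_empty_iff S).1 h4 ▸ Finset.mem_univ u
    exact (Finset.mem_filter.1 h5).2

/-- If the units of `ℤ / [H:K]ℤ` are generated by `U_(H,K)` and by exponents of Galois
automorphisms, then a central idempotent of `FG` fixes either all the idempotents `e_(χ^r)` or none
of them. -/
theorem centralIdempotents_trivial_of_closure_eq_top
    (hp : IsStrongShodaPair H K) (hh : IsGenerator H K h) {χ : H →* Lˣ}
    (hχ : χ.ker = K.subgroupOf H) (I : Set (ZMod (K.relIndex H))ˣ)
    (hI : ∀ u ∈ I, ∃ σ : L ≃ₐ[F] L,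
      (Units.map (σ : L →* L)).comp χ = χ ^ (u : ZMod (K.relIndex H)).val)
    (hW : Subgroup.closure (I ∪ conjUnits H K h) = ⊤)
    {z : MonoidAlgebra F G} (hz : z ∈ centralIdempotents (MonoidAlgebra F G))
    (hze : z * eOver F H K = z) : z = 0 ∨ z = eOver F H K := by
  classical
  let ι : MonoidAlgebra F G →+* MonoidAlgebra L G := MonoidAlgebra.mapRingHom G (algebraMap F L)
  have hι : Function.Injective ι := mapRingHom_injective (algebraMap F L).injective
  have heps : ι (eOver F H K) = conjSum (charSum K χ Finset.univ) :=
    mapRingHom_algebraMap_eOver_eq_conjSum hp hh hχ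
  have hιz : ι z ∈ centralIdempotents (MonoidAlgebra L G) :=
    ⟨mapRingHom_mem_center _ hz.1, hz.2.map ι⟩
  -- Whether `z` fixes `e_(χ^r)` depends only on the orbit of `r`.
  have hinv : ∀ u, ∀ r : (ZMod (K.relIndex H))ˣ, ι z * charSum K χ {r} = charSum K χ {r} →
      ι z * charSum K χ {u * r} = charSum K χ {u * r} := by
    intro u
    have hu : u ∈ Submonoid.closure (I ∪ conjUnits H K h) := by
      rw [← Subgroup.closure_toSubmonoid_of_finite, hW]
      trivial
    have hmap : ∀ v r : (ZMod (K.relIndex H))ˣ,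
        charSum K (χ ^ (v : ZMod (K.relIndex H)).val) {r} = charSum K χ {v * r} := by
      intro v r
      rw [charSum_pow hh hχ, Finset.map_singleton]
      rfl
    induction hu using Submonoid.closure_induction with
    | mem u hu =>
      intro r hr
      rw [← hmap]
      rcases hu with hu | hu
      · obtain ⟨σ, hσ⟩ := hI u hu
        have h1 : MonoidAlgebra.mapRingHom G (σ : L →+* L) (ι z) = ι z := by
          ext g
          simp [ι]
        have h2 := congrArg (MonoidAlgebra.mapRingHom G (σ : L →+* L)) hr
        rw [map_mul, h1, mapRingHom_charSum] at h2
        rw [← hσ]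
        exact h2
      · obtain ⟨ρ, hρ, hrange⟩ := exists_conjHom hp hh hχ
        rw [← hrange] at hu
        obtain ⟨g, rfl⟩ := hu
        have h2 := congrArg (conjBy (((Subgroup.inclusion inf_le_left g)⁻¹ :
          Subgroup.normalizer (H : Set G)) : G)) hr
        rw [conjBy_mul, conjBy_of_mem_center hιz.1, conjBy_charSum, hρ] at h2
        exact h2
    | one =>
      intro r hr
      rwa [one_mul]
    | mul u v _ _ hu hv =>
      intro r hr
      rw [mul_assoc]
      exact hu _ (hv _ hr)
  by_cases h1 : ι z * charSum K χ {1} = charSum K χ {1}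
  · right
    refine hze.symm.trans (hι ?_)
    rw [map_mul, heps]
    refine mul_conjSum_eq_self_of_mem_center hιz.1 ?_
    rw [charSum, Finset.mul_sum]
    refine Finset.sum_congr rfl fun r _ => ?_
    have := hinv r 1 h1
    rwa [mul_one, charSum_singleton] at this
  · left
    refine hze.symm.trans (hι ?_)
    rw [map_mul, heps, map_zero]
    refine mul_conjSum_eq_zero_of_mem_center hιz.1 ?_
    rw [charSum, Finset.mul_sum]
    refine Finset.sum_eq_zero fun r _ => ?_
    refine (centralIdempotent_mul_charIdem hp hh (ker_pow_unit hh hχ r) hιz).resolve_right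
      fun h2 => h1 ?_
    have := hinv r⁻¹ r (by rwa [charSum_singleton])
    rwa [inv_mul_cancel] at this

end Extension

/-- `FG` has no central idempotents strictly between `0` and `e(G, H, K)` exactly when `I_k(F)` and
`U_(H,K)` generate the units of `ℤ / [H:K]ℤ`. -/
theorem centralIdempotents_trivial_iff (hp : IsStrongShodaPair H K) (hh : IsGenerator H K h)
    {χ : H →* (CyclotomicField (K.relIndex H) F)ˣ} (hχ : χ.ker = K.subgroupOf H) :
    (∀ z ∈ centralIdempotents (MonoidAlgebra F G), z * eOver F H K = z →
      z = 0 ∨ z = eOver F H K) ↔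
    Subgroup.closure ((galoisImage F (K.relIndex H) : Set (ZMod (K.relIndex H))ˣ) ∪
      conjUnits H K h) = ⊤ := by
  have : IsGalois F (CyclotomicField (K.relIndex H) F) :=
    IsCyclotomicExtension.isGalois {K.relIndex H} F _
  have : FiniteDimensional F (CyclotomicField (K.relIndex H) F) :=
    IsCyclotomicExtension.finiteDimensional {K.relIndex H} F _
  constructor
  · refine eq_top_of_centralIdempotents_trivial hp hh hχ _ (fun σ => ?_) ?_
    · exact ⟨_, Subgroup.subset_closure (Or.inl ⟨σ, rfl⟩), map_comp_char hh hχ σ⟩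
    · exact Set.subset_union_right.trans Subgroup.subset_closure
  · intro hW z hz hze
    refine centralIdempotents_trivial_of_closure_eq_top hp hh hχ _ ?_ hW hz hze
    rintro _ ⟨σ, rfl⟩
    exact ⟨σ, map_comp_char hh hχ σ⟩

end Key

/-! ### Counting simple components -/

section Count

variable {G : Type*} [Group G] [Finite G] {H K : Subgroup G} {h : G}

/-- A field with a primitive `[H:K]`-th root of unity admits a character of `H` with kernel `K`. -/
theorem exists_char_ker_eq (hn : H ≤ Subgroup.normalizer (K : Set G)) (hh : IsGenerator H K h)
    {L : Type*} [Field L] {ζ : L} (hζ : IsPrimitiveRoot ζ (K.relIndex H)) :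
    ∃ χ : H →* Lˣ, χ.ker = K.subgroupOf H := by
  have hnormal : (K.subgroupOf H).Normal := Subgroup.normal_subgroupOf_of_le_normalizer hn
  have hcyc : IsCyclic (H ⧸ K.subgroupOf H) := by
    refine ⟨QuotientGroup.mk ⟨h, hh.1⟩, fun x => ?_⟩
    obtain ⟨x, rfl⟩ := QuotientGroup.mk_surjective x
    obtain ⟨n, hn⟩ := hh.2 x x.2
    refine ⟨n, ?_⟩
    simp only
    rw [← QuotientGroup.mk_zpow, QuotientGroup.eq, ← hnormal.mem_comm_iff]
    simpa [Subgroup.mem_subgroupOf] using hn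
  have hcard : Nat.card (H ⧸ K.subgroupOf H) = Nat.card (rootsOfUnity (K.relIndex H) L) := by
    rw [hζ.card_rootsOfUnity]
    rfl
  let φ := mulEquivOfCyclicCardEq hcard
  refine ⟨(rootsOfUnity (K.relIndex H) L).subtype.comp
    (φ.toMonoidHom.comp (QuotientGroup.mk' (K.subgroupOf H))), ?_⟩
  ext x
  simp [MonoidHom.mem_ker]

theorem isPrimitiveRoot_zeta (F : Type*) [Field F] [NumberField F] (k : ℕ) [NeZero k] :
    IsPrimitiveRoot (zeta F k) k :=
  IsCyclotomicExtension.zeta_spec k F (CyclotomicField k F)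

theorem galoisImage_eq_top (F : Type*) [Field F] [NumberField F] (k : ℕ) [NeZero k]
    (hk : Irreducible (Polynomial.cyclotomic k F)) : galoisImage F k = ⊤ :=
  MonoidHom.range_eq_top.2 (IsCyclotomicExtension.autEquivPow (CyclotomicField k F) hk).surjective

theorem eOver_rat (H K : Subgroup G) : eOver ℚ H K = e H K := by
  rw [eOver, Subsingleton.elim (Rat.castHom ℚ) (RingHom.id ℚ), MonoidAlgebra.mapRingHom_id]
  rfl

theorem e_mem_centralIdempotents (hp : IsStrongShodaPair H K) (hh : IsGenerator H K h) :
    e H K ∈ centralIdempotents (MonoidAlgebra ℚ G) := by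
  obtain ⟨χ, hχ⟩ := exists_char_ker_eq hp.le_normalizer hh
    (isPrimitiveRoot_zeta ℚ (K.relIndex H))
  exact (isConjOrthogonal_epsilon hp hh hχ).conjSum_mem

/-- `e(G, H, K)` is a primitive central idempotent of `ℚG`. -/
theorem centralIdempotent_rat_trivial (hp : IsStrongShodaPair H K) (hh : IsGenerator H K h)
    {z : MonoidAlgebra ℚ G} (hz : z ∈ centralIdempotents (MonoidAlgebra ℚ G))
    (hze : z * e H K = z) : z = 0 ∨ z = e H K := by
  obtain ⟨χ, hχ⟩ := exists_char_ker_eq hp.le_normalizer hh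
    (isPrimitiveRoot_zeta ℚ (K.relIndex H))
  have htop : Subgroup.closure ((galoisImage ℚ (K.relIndex H) : Set (ZMod (K.relIndex H))ˣ) ∪
      conjUnits H K h) = ⊤ := by
    rw [galoisImage_eq_top ℚ _ (Polynomial.cyclotomic.irreducible_rat
      (Nat.pos_of_ne_zero (NeZero.ne _))), Subgroup.coe_top, Set.univ_union, Subgroup.closure_univ]
  have := (centralIdempotents_trivial_iff hp hh hχ).2 htop z hz
  rw [eOver_rat] at this
  exact this hze

variable (F : Type*) [Field F] [NumberField F]

/-- `FG` and `ℚG` have equally many simple components exactly when the `e(G, H, K)`, for `(H, K)` in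
a complete set of representatives, remain primitive central idempotents in `FG`. -/
theorem numSimpleComponents_eq_iff_forall {X : Finset (Subgroup G × Subgroup G)}
    (hX : IsCompleteSet X) {h : Subgroup G × Subgroup G → G}
    (hh : ∀ p ∈ X, IsGenerator p.1 p.2 (h p)) :
    numSimpleComponents (MonoidAlgebra F G) = numSimpleComponents (MonoidAlgebra ℚ G) ↔
      ∀ p ∈ X, ∀ z ∈ centralIdempotents (MonoidAlgebra F G), z * eOver F p.1 p.2 = z →
        z = 0 ∨ z = eOver F p.1 p.2 := by
  classical
  have hF : NeZero (Nat.card G : F) := ⟨Nat.cast_ne_zero.2 Nat.card_pos.ne'⟩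
  have hQ : NeZero (Nat.card G : ℚ) := ⟨Nat.cast_ne_zero.2 Nat.card_pos.ne'⟩
  let f : MonoidAlgebra ℚ G →+* MonoidAlgebra F G := MonoidAlgebra.mapRingHom G (Rat.castHom F)
  have hf : Function.Injective f := mapRingHom_injective (Rat.castHom F).injective
  rw [numSimpleComponents_eq_iff f hf fun z hz => mapRingHom_mem_center _ hz]
  constructor
  · intro hsurj p hp z hz hze
    obtain ⟨w, hw, rfl⟩ := hsurj z hz
    have hwe : w * e p.1 p.2 = w := hf (by rw [map_mul]; exact hze)
    refine (centralIdempotent_rat_trivial (hX.isStrongShodaPair p hp) (hh p hp) hw hwe).imp ?_ ?_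
    · rintro rfl
      exact map_zero f
    · rintro rfl
      rfl
  · intro htriv z hz
    have hecI : ∀ p ∈ X, eOver F p.1 p.2 ∈ centralIdempotents (MonoidAlgebra F G) := by
      intro p hp
      have := e_mem_centralIdempotents (hX.isStrongShodaPair p hp) (hh p hp)
      exact ⟨mapRingHom_mem_center _ this.1, this.2.map f⟩
    have hsum : ∑ p ∈ X, z * eOver F p.1 p.2 = z := by
      rw [← Finset.mul_sum]
      have : ∑ p ∈ X, eOver F p.1 p.2 = f (∑ p ∈ X, e p.1 p.2) := (map_sum f _ _).symm
      rw [this, hX.sum_eq_one, map_one, mul_one]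
    have hcase : ∀ p ∈ X, z * eOver F p.1 p.2 = 0 ∨ z * eOver F p.1 p.2 = eOver F p.1 p.2 := by
      intro p hp
      have hcomm : Commute z (eOver F p.1 p.2) := Semigroup.mem_center_iff.1 (hecI p hp).1 z
      refine htriv p hp _ ⟨Set.mul_mem_center hz.1 (hecI p hp).1,
        hz.2.mul_of_commute hcomm (hecI p hp).2⟩ ?_
      rw [mul_assoc, (hecI p hp).2.eq]
    let w : MonoidAlgebra ℚ G :=
      ∑ p ∈ X.filter (fun p => z * eOver F p.1 p.2 ≠ 0), e p.1 p.2
    have hfw : f w = z := by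
      rw [map_sum, Finset.sum_filter]
      refine Eq.trans ?_ hsum
      refine Finset.sum_congr rfl fun p hp => ?_
      split_ifs with h0
      · exact ((hcase p hp).resolve_left h0).symm
      · exact (not_not.1 h0).symm
    refine ⟨w, ⟨Semigroup.mem_center_iff.2 fun a => hf ?_, hf ?_⟩, hfw⟩
    · rw [map_mul, map_mul, hfw, Semigroup.mem_center_iff.1 hz.1]
    · rw [map_mul, hfw, hz.2.eq]

end Count

/-! ### Stabilizers of Galois orbits -/

section Stabilizer

variable {G : Type*} [Group G] [Finite G] {H K : Subgroup G} {h : G}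
variable {F : Type*} [Field F] [NumberField F]

theorem galoisOrbit_eq (hh : IsGenerator H K h)
    {χ : H →* (CyclotomicField (K.relIndex H) F)ˣ} (hχ : χ.ker = K.subgroupOf H) :
    galoisOrbit F χ = {ψ | ∃ u ∈ galoisImage F (K.relIndex H),
      ψ = χ ^ (u : ZMod (K.relIndex H)).val} := by
  ext ψ
  constructor
  · rintro ⟨σ, rfl⟩
    exact ⟨_, ⟨σ, rfl⟩, map_comp_char hh hχ σ⟩
  · rintro ⟨_, ⟨σ, rfl⟩, rfl⟩
    exact ⟨σ, map_comp_char hh hχ σ⟩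

/-- `E_F(G, H / K)` is the preimage of `I_k(F)` under the action of `N_G(K)` on `H / K`. -/
theorem stab_galoisOrbit (hh : IsGenerator H K h)
    {χ : H →* (CyclotomicField (K.relIndex H) F)ˣ} (hχ : χ.ker = K.subgroupOf H)
    {ρ : (Subgroup.normalizer (H : Set G) ⊓ Subgroup.normalizer (K : Set G) : Subgroup G) →*
      (ZMod (K.relIndex H))ˣ}
    (hρ : ∀ g, conjChar (Subgroup.inclusion inf_le_left g)⁻¹ χ =
      χ ^ (ρ g : ZMod (K.relIndex H)).val) :
    stab H K (galoisOrbit F χ) = (galoisImage F (K.relIndex H)).comap ρ := by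
  set I := galoisImage F (K.relIndex H)
  have hconj : ∀ g (u : (ZMod (K.relIndex H))ˣ), conjChar (Subgroup.inclusion inf_le_left g)
      (χ ^ (u : ZMod (K.relIndex H)).val) =
      χ ^ (((ρ g)⁻¹ * u : (ZMod (K.relIndex H))ˣ) : ZMod (K.relIndex H)).val := by
    intro g u
    have h1 := hρ g⁻¹
    rw [map_inv, inv_inv, map_inv] at h1
    rw [conjChar_pow, h1, char_pow_val_pow_val hh hχ, Units.val_mul]
  ext g
  rw [Subgroup.mem_comap]
  change conjChar (Subgroup.inclusion inf_le_left g) '' galoisOrbit F χ = galoisOrbit F χ ↔ _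
  rw [galoisOrbit_eq hh hχ]
  constructor
  · intro himg
    have h1 : conjChar (Subgroup.inclusion inf_le_left g)
        (χ ^ ((1 : (ZMod (K.relIndex H))ˣ) : ZMod (K.relIndex H)).val) ∈
        {ψ | ∃ u ∈ I, ψ = χ ^ (u : ZMod (K.relIndex H)).val} :=
      himg ▸ Set.mem_image_of_mem _ ⟨1, I.one_mem, rfl⟩
    obtain ⟨u, hu, hgu⟩ := h1
    rw [hconj, mul_one] at hgu
    have h2 : (ρ g)⁻¹ = u := char_pow_unit_injective hh hχ hgu
    rw [← I.inv_mem_iff, h2]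
    exact hu
  · intro hg
    ext ψ
    constructor
    · rintro ⟨_, ⟨u, hu, rfl⟩, rfl⟩
      exact ⟨_, I.mul_mem (I.inv_mem hg) hu, hconj g u⟩
    · rintro ⟨u, hu, rfl⟩
      exact ⟨_, ⟨ρ g * u, I.mul_mem hg hu, rfl⟩, by rw [hconj, inv_mul_cancel_left]⟩

/-- Since `|N_G(K)| / |E_F(G, H / K)|` is the index of `I_k(F)` in the subgroup generated by
`I_k(F)` and `U_(H,K)`, the right-hand side is the order of that subgroup. -/
theorem totient_eq_iff (hp : IsStrongShodaPair H K) (hh : IsGenerator H K h)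
    {C : Set (H →* (CyclotomicField (K.relIndex H) F)ˣ)} (hC : C ∈ orbits F H K) :
    (Nat.totient (K.relIndex H) : ℚ) = Nat.card (galoisImage F (K.relIndex H)) *
      (Nat.card (Subgroup.normalizer (K : Set G)) / Nat.card (stab H K C)) ↔
    Subgroup.closure ((galoisImage F (K.relIndex H) : Set (ZMod (K.relIndex H))ˣ) ∪
      conjUnits H K h) = ⊤ := by
  obtain ⟨χ, hχ, rfl⟩ := hC
  obtain ⟨ρ, hρ, hrange⟩ := exists_conjHom hp hh hχ
  set I := galoisImage F (K.relIndex H)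
  have hclosure : Subgroup.closure ((I : Set (ZMod (K.relIndex H))ˣ) ∪ conjUnits H K h) =
      I ⊔ ρ.range := by
    rw [← hrange, Subgroup.closure_union, Subgroup.closure_eq, Subgroup.closure_eq]
  have hN : Nat.card (Subgroup.normalizer (K : Set G)) = Nat.card
      (Subgroup.normalizer (H : Set G) ⊓ Subgroup.normalizer (K : Set G) : Subgroup G) := by
    rw [inf_eq_right.2 hp.normalizer_le]
  have hdiv : (Nat.card (Subgroup.normalizer (K : Set G)) : ℚ) /
      Nat.card (stab H K (galoisOrbit F χ)) = I.relIndex (I ⊔ ρ.range) := by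
    rw [Subgroup.relIndex_sup_left, ← Subgroup.index_comap, stab_galoisOrbit hh hχ hρ, hN,
      ← (I.comap ρ).card_mul_index, Nat.cast_mul, mul_div_cancel_left₀]
    exact Nat.cast_ne_zero.2 Nat.card_pos.ne'
  have hcard : Nat.card I * I.relIndex (I ⊔ ρ.range) = Nat.card (I ⊔ ρ.range : Subgroup _) := by
    rw [← Subgroup.relIndex_bot_left, ← Subgroup.relIndex_bot_left]
    exact Subgroup.relIndex_mul_relIndex _ _ _ bot_le le_sup_left
  rw [hdiv, hclosure, ← Nat.cast_mul, Nat.cast_inj, hcard, ← Subgroup.card_eq_iff_eq_top,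
    Nat.card_eq_fintype_card (α := (ZMod (K.relIndex H))ˣ), ZMod.card_units_eq_totient]
  exact eq_comm

end Stabilizer

/-! ### The fixed field and the base field -/

section FixedField

variable (F : Type*) [Field F] [NumberField F]

section Cyclotomic

variable (k : ℕ) [NeZero k]

theorem isCyclotomicExtension_ratCyclotomic :
    IsCyclotomicExtension {k} ℚ (ratCyclotomic F k) :=
  have : FiniteDimensional F (CyclotomicField k F) :=
    IsCyclotomicExtension.finiteDimensional {k} F _
  have : IsScalarTower ℚ F (CyclotomicField k F) :=
    IsScalarTower.of_algebraMap_eq' (Subsingleton.elim _ _)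
  have : Algebra.IsIntegral ℚ (CyclotomicField k F) := Algebra.IsIntegral.trans F
  (isPrimitiveRoot_zeta F k).intermediateField_adjoin_isCyclotomicExtension ℚ

/-- The generator `ζ_k` of `ℚ(ζ_k)`. -/
def ratZeta : ratCyclotomic F k := IntermediateField.AdjoinSimple.gen ℚ (zeta F k)

theorem coe_ratZeta : (ratZeta F k : CyclotomicField k F) = zeta F k :=
  IntermediateField.AdjoinSimple.coe_gen ℚ (zeta F k)

theorem isPrimitiveRoot_ratZeta : IsPrimitiveRoot (ratZeta F k) k :=
  IsPrimitiveRoot.coe_submonoidClass_iff.1 (coe_ratZeta F k ▸ isPrimitiveRoot_zeta F k)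

/-- The isomorphism of `Gal(ℚ(ζ_k) / ℚ)` onto the units of `ℤ / kℤ`. -/
def ratGalEquiv : (ratCyclotomic F k ≃ₐ[ℚ] ratCyclotomic F k) ≃* (ZMod k)ˣ :=
  MulEquiv.ofBijective ((isPrimitiveRoot_ratZeta F k).autToPow ℚ) <| by
    have := isCyclotomicExtension_ratCyclotomic F k
    have hirr := Polynomial.cyclotomic.irreducible_rat (Nat.pos_of_ne_zero (NeZero.ne k))
    have : IsGalois ℚ (ratCyclotomic F k) := IsCyclotomicExtension.isGalois {k} ℚ _
    have : FiniteDimensional ℚ (ratCyclotomic F k) :=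
      IsCyclotomicExtension.finiteDimensional {k} ℚ _
    refine ((isPrimitiveRoot_ratZeta F k).autToPow_injective (K := ℚ)).bijective_of_nat_card_le ?_
    rw [IsGalois.card_aut_eq_finrank, IsCyclotomicExtension.finrank (n := k) _ hirr,
      Nat.card_eq_fintype_card, ZMod.card_units_eq_totient]

theorem ratGalEquiv_spec (τ : ratCyclotomic F k ≃ₐ[ℚ] ratCyclotomic F k) :
    (τ (ratZeta F k) : CyclotomicField k F) = zeta F k ^ (ratGalEquiv F k τ : ZMod k).val := by
  rw [← coe_ratZeta, ← SubmonoidClass.coe_pow]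
  exact congrArg _ ((isPrimitiveRoot_ratZeta F k).autToPow_spec ℚ τ).symm

/-- An element of `ℚ(ζ_k)` lies in `F` when it is fixed by the automorphisms of `ℚ(ζ_k)` given by
the elements of `I_k(F)`. -/
theorem coe_mem_baseField_iff (y : ratCyclotomic F k) :
    (y : CyclotomicField k F) ∈ baseField F k ↔
      ∀ τ, ratGalEquiv F k τ ∈ galoisImage F k → τ y = y := by
  set L := CyclotomicField k F
  have hres : ∀ (σ : L ≃ₐ[F] L) (τ : ratCyclotomic F k ≃ₐ[ℚ] ratCyclotomic F k),
      ratGalEquiv F k τ = (isPrimitiveRoot_zeta F k).autToPow F σ →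
      ∀ y : ratCyclotomic F k, σ y = τ y := by
    intro σ τ hστ
    have h1 : ((σ : L →+* L).toRatAlgHom.comp (ratCyclotomic F k).val) =
        (ratCyclotomic F k).val.comp (τ : ratCyclotomic F k →ₐ[ℚ] ratCyclotomic F k) := by
      refine IntermediateField.algHom_ext_of_eq_adjoin ℚ (s := {zeta F k}) rfl ?_
      rintro x rfl
      have h2 := (isPrimitiveRoot_zeta F k).autToPow_spec F σ
      have h3 := ratGalEquiv_spec F k τ
      rw [hστ, h2] at h3
      exact h3.symm
    exact fun y => congrArg (fun φ => φ y) h1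
  have hbase : (y : L) ∈ baseField F k ↔ ∀ σ : L ≃ₐ[F] L, σ y = y := by
    have : IsGalois F L := IsCyclotomicExtension.isGalois {k} F _
    have : FiniteDimensional F L := IsCyclotomicExtension.finiteDimensional {k} F _
    rw [← IsGalois.mem_range_algebraMap_iff_fixed]
    exact Iff.rfl
  rw [hbase]
  constructor
  · rintro hfix τ ⟨σ, hσ⟩
    refine Subtype.ext ?_
    rw [← hres σ τ hσ.symm, hfix σ]
  · intro hfix σ
    have h1 := hfix ((ratGalEquiv F k).symm ((isPrimitiveRoot_zeta F k).autToPow F σ))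
      ⟨σ, ((ratGalEquiv F k).apply_symm_apply _).symm⟩
    rw [hres σ _ ((ratGalEquiv F k).apply_symm_apply _), h1]

end Cyclotomic

variable {G : Type*} [Group G] [Finite G] {H K : Subgroup G} {h : G} {F}

/-- The automorphisms by which `N_G(K) / H` acts are those whose exponents lie in `U_(H,K)`; they
already form a group. -/
theorem mem_actingGroup_iff (hp : IsStrongShodaPair H K) (hh : IsGenerator H K h)
    (τ : ratCyclotomic F (K.relIndex H) ≃ₐ[ℚ] ratCyclotomic F (K.relIndex H)) :
    τ ∈ actingGroup F H K h ↔ ratGalEquiv F (K.relIndex H) τ ∈ conjUnits H K h := by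
  set k := K.relIndex H
  have hz := isPrimitiveRoot_zeta F k
  obtain ⟨χ, hχ⟩ := exists_char_ker_eq hp.le_normalizer hh hz
  obtain ⟨ρ, -, hrange⟩ := exists_conjHom hp hh hχ
  have hset : {τ : ratCyclotomic F k ≃ₐ[ℚ] ratCyclotomic F k |
      ∃ g ∈ Subgroup.normalizer (K : Set G), ∃ i : ℕ, g⁻¹ * h * g * (h ^ i)⁻¹ ∈ K ∧
      (τ (IntermediateField.AdjoinSimple.gen ℚ (zeta F k)) : CyclotomicField k F) =
        zeta F k ^ i} = ρ.range.comap (ratGalEquiv F k).toMonoidHom := by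
    ext τ
    have h0 : τ ∈ ρ.range.comap (ratGalEquiv F k).toMonoidHom ↔
        ratGalEquiv F k τ ∈ conjUnits H K h := by
      rw [← hrange]
      rfl
    rw [SetLike.mem_coe, h0]
    constructor
    · rintro ⟨g, hg, i, hi, hτ⟩
      refine ⟨g, hg, ?_⟩
      have h1 : zeta F k ^ (ratGalEquiv F k τ : ZMod k).val = zeta F k ^ i :=
        (ratGalEquiv_spec F k τ).symm.trans hτ
      have h2 : χ ^ i = χ ^ (ratGalEquiv F k τ : ZMod k).val := by
        rw [char_pow_eq_pow_iff hh hχ]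
        refine hz.pow_inj (Nat.mod_lt _ (NeZero.pos k)) (Nat.mod_lt _ (NeZero.pos k)) ?_
        rw [← pow_eq_pow_mod _ hz.pow_eq_one, ← pow_eq_pow_mod _ hz.pow_eq_one, h1]
      have h3 : (⟨h, hh.1⟩ ^ i * (⟨h, hh.1⟩ ^ (ratGalEquiv F k τ : ZMod k).val)⁻¹ : H) ∈ χ.ker := by
        rw [MonoidHom.mem_ker, map_mul, map_inv, map_pow, map_pow, mul_inv_eq_one]
        exact congrArg (fun ψ => ψ ⟨h, hh.1⟩) h2
      rw [hχ] at h3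
      have h4 := K.mul_mem hi h3
      simpa [mul_assoc] using h4
    · rintro ⟨g, hg, hr⟩
      exact ⟨g, hg, _, hr, ratGalEquiv_spec F k τ⟩
  rw [actingGroup, hset, Subgroup.closure_eq, ← hrange]
  rfl

/-- The intersection of the fixed field with `F` is the fixed field, in `ℚ(ζ_k)`, of the
automorphisms that correspond to the subgroup generated by `I_k(F)` and `U_(H,K)`. -/
theorem finrank_eq_one_iff_closure_eq_top (hp : IsStrongShodaPair H K) (hh : IsGenerator H K h) :
    Module.finrank ℚ ↥(fixedCyclotomic F H K h ⊓ baseField F (K.relIndex H)) = 1 ↔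
    Subgroup.closure ((galoisImage F (K.relIndex H) : Set (ZMod (K.relIndex H))ˣ) ∪
      conjUnits H K h) = ⊤ := by
  set k := K.relIndex H
  set W := Subgroup.closure ((galoisImage F k : Set (ZMod k)ˣ) ∪ conjUnits H K h) with hW
  have := isCyclotomicExtension_ratCyclotomic F k
  have : IsGalois ℚ (ratCyclotomic F k) := IsCyclotomicExtension.isGalois {k} ℚ _
  have : FiniteDimensional ℚ (ratCyclotomic F k) :=
    IsCyclotomicExtension.finiteDimensional {k} ℚ _
  let J : Subgroup (ratCyclotomic F k ≃ₐ[ℚ] ratCyclotomic F k) :=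
    W.comap (ratGalEquiv F k).toMonoidHom
  have hfix : ∀ y : ratCyclotomic F k, (y : CyclotomicField k F) ∈ fixedCyclotomic F H K h ↔
      ∀ τ ∈ actingGroup F H K h, τ y = y := fun y =>
    (IntermediateField.mem_lift y).trans (IntermediateField.mem_fixedField_iff _ y)
  have key : ∀ y : ratCyclotomic F k,
      (y : CyclotomicField k F) ∈ fixedCyclotomic F H K h ⊓ baseField F k ↔
      y ∈ IntermediateField.fixedField J := by
    intro y
    rw [IntermediateField.mem_inf, hfix, IntermediateField.mem_fixedField_iff,
      coe_mem_baseField_iff]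
    constructor
    · rintro ⟨h1, h2⟩ τ hτ
      -- The stabilizer of `y`, transported to the units, contains both sets of generators.
      have hle : W ≤ ((MulAction.stabilizer (ratCyclotomic F k ≃ₐ[ℚ] ratCyclotomic F k) y).comap
          (ratGalEquiv F k).symm.toMonoidHom) := by
        rw [hW, Subgroup.closure_le]
        rintro u (hu | hu)
        · exact h2 _ (((ratGalEquiv F k).apply_symm_apply u).symm ▸ hu)
        · exact h1 _ ((mem_actingGroup_iff hp hh _).2
            (((ratGalEquiv F k).apply_symm_apply u).symm ▸ hu))
      have h3 := hle hτ
      have h4 : (ratGalEquiv F k).symm (ratGalEquiv F k τ) • y = y := h3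
      rwa [MulEquiv.symm_apply_apply] at h4
    · intro h1
      exact ⟨fun τ hτ => h1 τ (Subgroup.subset_closure
        (Or.inr ((mem_actingGroup_iff hp hh τ).1 hτ))),
        fun τ hτ => h1 τ (Subgroup.subset_closure (Or.inl hτ))⟩
  have hbot : fixedCyclotomic F H K h ⊓ baseField F k = ⊥ ↔
      IntermediateField.fixedField J = ⊥ := by
    rw [eq_bot_iff, eq_bot_iff]
    constructor
    · intro hle y hy
      obtain ⟨q, hq⟩ := IntermediateField.mem_bot.1 (hle ((key y).2 hy))
      exact IntermediateField.mem_bot.2 ⟨q, Subtype.ext (by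
        rw [← hq, eq_ratCast, eq_ratCast, SubfieldClass.coe_ratCast])⟩
    · intro hle x hx
      have hxQ : x ∈ ratCyclotomic F k := IntermediateField.lift_le _ hx.1
      obtain ⟨q, hq⟩ := IntermediateField.mem_bot.1 (hle ((key ⟨x, hxQ⟩).1 hx))
      exact IntermediateField.mem_bot.2 ⟨q, by
        rw [← show ((⟨x, hxQ⟩ : ratCyclotomic F k) : CyclotomicField k F) = x from rfl, ← hq,
          eq_ratCast, eq_ratCast, SubfieldClass.coe_ratCast]⟩
  rw [IntermediateField.finrank_eq_one_iff, hbot]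
  constructor
  · intro hfixed
    have hJ : J = ⊤ := by
      rw [← IntermediateField.fixingSubgroup_fixedField J, hfixed,
        IntermediateField.fixingSubgroup_bot]
    refine (Subgroup.eq_top_iff' _).2 fun u => ?_
    have h1 : (ratGalEquiv F k).symm u ∈ J := hJ ▸ Subgroup.mem_top _
    have h2 : ratGalEquiv F k ((ratGalEquiv F k).symm u) ∈ W := h1
    rwa [MulEquiv.apply_symm_apply] at h2
  · intro htop
    have hJ : J = ⊤ := by
      rw [show J = W.comap (ratGalEquiv F k).toMonoidHom from rfl, htop, Subgroup.comap_top]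
    rw [hJ, IsGalois.fixedField_top]

end FixedField

end StrongShoda

end

open StrongShoda in
theorem mainTheorem5 {G : Type*} [Group G] [Finite G] (hG : IsStronglyMonomial G)
    (F : Type*) [Field F] [NumberField F]
    (X : Finset (Subgroup G × Subgroup G)) (hX : IsCompleteSet X)
    (h : Subgroup G × Subgroup G → G) (hh : ∀ p ∈ X, IsGenerator p.1 p.2 (h p))
    (C : ∀ p : Subgroup G × Subgroup G,
      Set (p.1 →* (CyclotomicField (p.2.relIndex p.1) F)ˣ))
    (hC : ∀ p ∈ X, C p ∈ orbits F p.1 p.2) :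
    List.TFAE [
      numSimpleComponents (MonoidAlgebra F G) = numSimpleComponents (MonoidAlgebra ℚ G),
      ∀ p ∈ X, Subgroup.closure
        ((galoisImage F (p.2.relIndex p.1) : Set (ZMod (p.2.relIndex p.1))ˣ) ∪
          conjUnits p.1 p.2 (h p)) = ⊤,
      ∀ p ∈ X, (Nat.totient (p.2.relIndex p.1) : ℚ) =
        Nat.card (galoisImage F (p.2.relIndex p.1)) *
          (Nat.card (Subgroup.normalizer (p.2 : Set G)) / Nat.card (stab p.1 p.2 (C p))),
      ∀ p ∈ X, Module.finrank ℚ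
        ↥(fixedCyclotomic F p.1 p.2 (h p) ⊓ baseField F (p.2.relIndex p.1)) = 1] := by
  tfae_have 1 ↔ 2 := by
    rw [numSimpleComponents_eq_iff_forall F hX hh]
    refine forall₂_congr fun p hp => ?_
    obtain ⟨χ, hχ, -⟩ := hC p hp
    exact centralIdempotents_trivial_iff (hX.isStrongShodaPair p hp) (hh p hp) hχ
  tfae_have 3 ↔ 2 := forall₂_congr fun p hp =>
    totient_eq_iff (hX.isStrongShodaPair p hp) (hh p hp) (hC p hp)
  tfae_have 4 ↔ 2 := forall₂_congr fun p hp =>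
    finrank_eq_one_iff_closure_eq_top (hX.isStrongShodaPair p hp) (hh p hp)
  tfae_finish
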